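/- **Setting.** Let $(M,g,F)$ be an oriented smooth 4-dimensional electrovac spacetime: $g$ has signature $(-,+,+,+)$, $F$ is a smooth 2-form, $dF=0=d\star F$ and $\mathrm{Ric}-\tfrac12 R\,g+\Lambda g=\kappa_0T$ with $T_{\mu\nu}=F_{\mu\alpha}F_\nu{}^\alpha-\tfrac14 g_{\mu\nu}F_{\alpha\beta}F^{\alpha\beta}$, where $\kappa_0>0$ and $\Lambda$ are fixed constants ($\Lambda=0$ is allowed). Let $\Delta\subset M$ be an embedded null hypersurface and $K$ a Killing vector field with $\mathcal L_KF=0$ that is tangent to $\Delta$ and null on $\Delta$; put $\ell=K|_\Delta$. We call $(\Delta,\ell)$ a Killing horizon. (Non-expanding horizons, which have the global structure (compact surface) $\times$ (interval), are a special case when they carry such a $K$.) Let its surface gravity $\kappa$, defined by $\nabla_\ell\ell=\kappa\,\ell$, be non-zero on $\Delta$. The rotation 1-form $\omega_a$ on $\Delta$ is defined by $\nabla_X\ell=\omega(X)\ell$ for $X$ tangent to $\Delta$. *Bondi-like coordinates* are coordinates $(x^1,x^2,v,r)$ near (a part of) $\Delta$ in which $\Delta=\{r=0\}$, $\ell=\partial_v$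 on $\Delta$, the field $n=-\partial_r$ is null with $\nabla_nn=0$, and the pullback of $g(n,\cdot)$ to $\Delta$ is $-dv$. An *adapted null frame* in such coordinates is a smooth frame $(e_1,e_2,e_3,e_4)=(m,\bar m,n,\ell)$, with $n=-\partial_r$, the last vector real and extending $\ell$ off $\Delta$, whose only non-zero scalar products are $g(m,\bar m)=1$ and $g(n,\ell)=-1$, such that $(\mathrm{Re}\,m,\mathrm{Im}\,m,n,\ell)$ is positively oriented and $\nabla_ne_\mu=0$, and such that on $\Delta$ one has $e_4=\partial_v$, $m$ is tangent to the slices $v=\mathrm{const}$ of $\Delta$, and $\mathcal L_\ell m=0$. Let $(e^\mu)$ be the dual coframe and put $\Phi_0=F(e_4,e_1)$, $\Phi_1=\tfrac12\big(F(e_4,e_3)+F(e_2,e_1)\big)$, $\Phi_2=F(e_2,e_3)$. **Corollary.** The following data on $\Delta$: the complex vector $m^a$, the rotation 1-form $\omega_a$, and the pullback to $\Delta$ of $F-i\star F$, uniquely determine at $\Delta$ all the radial derivatives $\partial_r^n$, $n=0,1,2,\dots$, of the components of the frame $(e_\mu)$ and of the coframe $(e^\mu)$ in the Bondi-like coordinates,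 and of $\Phi_0,\Phi_1,\Phi_2$. Explicitly: let two such Killing horizons, in spacetimes with the same $\kappa_0$ and $\Lambda$, be given with Bondi-like coordinates and adapted null frames. If the components of $m^a$, of $\omega_a$ and of the pullback of $F-i\star F$ in the horizon coordinates $(x^1,x^2,v)$ coincide on an open set $U$ of values of $(x^1,x^2,v)$, then for every $n\ge0$ and at every point of $U$ (that is, at $r=0$) the derivatives $\partial_r^n$ of all frame components, of all coframe components and of $\Phi_0,\Phi_1,\Phi_2$ coincide for the two horizons. -/

import Mathlib

open scoped Manifold ContDiff

noncomputable section

namespace EMHorizon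

/-- Coordinate space `ℝ⁴`, the model space of a 4-dimensional spacetime. -/
abbrev Coord : Type := Fin 4 → ℝ

/-- Charts of a 4-dimensional manifold. -/
abbrev Chart (M : Type*) [TopologicalSpace M] : Type _ := OpenPartialHomeomorph M Coord

/-- Partial derivative `∂f/∂yⁱ` of a real or complex valued function of four coordinates. -/
def pd {V : Type*} [NormedAddCommGroup V] [NormedSpace ℝ V]
    (i : Fin 4) (f : Coord → V) (y : Coord) : V :=
  fderiv ℝ f y (Pi.single i 1)

/-- Vector fields and covariant tensor fields of rank 2 on `M`. -/
abbrev VField (M : Type*) [TopologicalSpace M] [ChartedSpace Coord M] : Type _ :=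
  ∀ p : M, TangentSpace 𝓘(ℝ, Coord) p

abbrev Tensor2 (M : Type*) [TopologicalSpace M] [ChartedSpace Coord M] : Type _ :=
  ∀ p : M, TangentSpace 𝓘(ℝ, Coord) p →ₗ[ℝ] TangentSpace 𝓘(ℝ, Coord) p →ₗ[ℝ] ℝ

/-- 4-forms on `M`. -/
abbrev FourForm (M : Type*) [TopologicalSpace M] [ChartedSpace Coord M] : Type _ :=
  ∀ p : M, (TangentSpace 𝓘(ℝ, Coord) p) [⋀^Fin 4]→ₗ[ℝ] ℝ

section Components

variable {M : Type*} [TopologicalSpace M] [ChartedSpace Coord M]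

/-- The coordinate vector `∂_i` of the chart `φ` at the point with coordinates `y`. -/
def coordVec (φ : Chart M) (i : Fin 4) (y : Coord) :
    TangentSpace 𝓘(ℝ, Coord) (φ.symm y) :=
  mfderiv 𝓘(ℝ, Coord) 𝓘(ℝ, Coord) φ.symm y (Pi.single i 1 : Coord)

/-- Components `T_ij` of a covariant 2-tensor, as functions of the coordinates. -/
def comp2 (T : Tensor2 M) (φ : Chart M) (i j : Fin 4) (y : Coord) : ℝ :=
  T (φ.symm y) (coordVec φ i y) (coordVec φ j y)

/-- Components of a 4-form. -/
def comp4 (T : FourForm M) (φ : Chart M) (i j k l : Fin 4) (y : Coord) : ℝ :=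
  T (φ.symm y) ![coordVec φ i y, coordVec φ j y, coordVec φ k y, coordVec φ l y]

/-- Components `Kⁱ` of a vector field. -/
def vcomp (K : VField M) (φ : Chart M) (i : Fin 4) (y : Coord) : ℝ :=
  (mfderiv 𝓘(ℝ, Coord) 𝓘(ℝ, Coord) φ (φ.symm y) (K (φ.symm y)) : Coord) i

end Components

/-- An oriented 4-dimensional spacetime with an electromagnetic field: a smooth metric `g` of
signature `(-,+,+,+)`, its volume form `vol`, and a smooth 2-form `F`. -/
structure EMSpacetime (M : Type*) [TopologicalSpace M] [ChartedSpace Coord M] where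
  g : Tensor2 M
  vol : FourForm M
  F : Tensor2 M
  g_symm : ∀ p u w, g p u w = g p w u
  g_lorentz : ∀ p, ∃ b : Module.Basis (Fin 4) ℝ (TangentSpace 𝓘(ℝ, Coord) p),
    ∀ i j, g p (b i) (b j) = if i = j then (if i = 0 then -1 else 1) else 0
  g_smooth : ∀ φ ∈ IsManifold.maximalAtlas 𝓘(ℝ, Coord) ∞ M, ∀ i j,
    ContDiffOn ℝ ∞ (comp2 g φ i j) φ.target
  /-- Gram determinant identity: `vol` takes the values `±1` on orthonormal bases. -/
  vol_metric : ∀ p (u : Fin 4 → TangentSpace 𝓘(ℝ, Coord) p),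
    (vol p u) ^ 2 = -(Matrix.of fun i j => g p (u i) (u j)).det
  vol_smooth : ∀ φ ∈ IsManifold.maximalAtlas 𝓘(ℝ, Coord) ∞ M, ∀ i j k l,
    ContDiffOn ℝ ∞ (comp4 vol φ i j k l) φ.target
  F_antisymm : ∀ p u w, F p u w = -F p w u
  F_smooth : ∀ φ ∈ IsManifold.maximalAtlas 𝓘(ℝ, Coord) ∞ M, ∀ i j,
    ContDiffOn ℝ ∞ (comp2 F φ i j) φ.target

namespace EMSpacetime

variable {M : Type*} [TopologicalSpace M] [ChartedSpace Coord M] (S : EMSpacetime M)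

/-- Inverse metric `g^{ij}` in a chart. -/
def ginv (φ : Chart M) (i j : Fin 4) (y : Coord) : ℝ :=
  (Matrix.of fun a b => comp2 S.g φ a b y)⁻¹ i j

/-- Christoffel symbols `Γ^k_{ij}` of the Levi-Civita connection. -/
def Gam (φ : Chart M) (k i j : Fin 4) (y : Coord) : ℝ :=
  (1 / 2 : ℝ) * ∑ l, S.ginv φ k l y *
    (pd i (comp2 S.g φ j l) y + pd j (comp2 S.g φ i l) y - pd l (comp2 S.g φ i j) y)

/-- Ricci tensor `R_ij = R^k_{ikj}`. -/
def ricci (φ : Chart M) (i j : Fin 4) (y : Coord) : ℝ :=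
  (∑ k, pd k (S.Gam φ k i j) y) - (∑ k, pd j (S.Gam φ k i k) y)
    + ∑ k, ∑ l, (S.Gam φ k k l y * S.Gam φ l i j y - S.Gam φ k j l y * S.Gam φ l i k y)

/-- Scalar curvature. -/
def scal (φ : Chart M) (y : Coord) : ℝ :=
  ∑ i, ∑ j, S.ginv φ i j y * S.ricci φ i j y

/-- Maxwell energy-momentum tensor `T_ij = F_ik F_j^k - (1/4) g_ij F_kl F^kl`. -/
def stress (φ : Chart M) (i j : Fin 4) (y : Coord) : ℝ :=
  (∑ k, ∑ l, S.ginv φ k l y * comp2 S.F φ i k y * comp2 S.F φ j l y)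
    - (1 / 4 : ℝ) * comp2 S.g φ i j y *
      ∑ k, ∑ l, ∑ a, ∑ b, S.ginv φ k a y * S.ginv φ l b y *
        comp2 S.F φ k l y * comp2 S.F φ a b y

/-- Components of the Hodge dual: `(⋆F)_ij = (1/2) vol_ijkl F^kl`. -/
def starF (φ : Chart M) (i j : Fin 4) (y : Coord) : ℝ :=
  (1 / 2 : ℝ) * ∑ k, ∑ l, ∑ a, ∑ b, comp4 S.vol φ i j k l y *
    S.ginv φ k a y * S.ginv φ l b y * comp2 S.F φ a b y

/-- The vacuum Einstein-Maxwell equations, `G + Λ g = κ₀ T` and `dF = 0 = d⋆F`, written in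
the charts of `M`; `κ₀` is the gravitational coupling constant. -/
structure IsElectrovac (κ₀ Λ : ℝ) : Prop where
  einstein : ∀ φ ∈ IsManifold.maximalAtlas 𝓘(ℝ, Coord) ∞ M, ∀ y ∈ φ.target, ∀ i j,
    S.ricci φ i j y - (1 / 2 : ℝ) * S.scal φ y * comp2 S.g φ i j y + Λ * comp2 S.g φ i j y
      = κ₀ * S.stress φ i j y
  maxwell : ∀ φ ∈ IsManifold.maximalAtlas 𝓘(ℝ, Coord) ∞ M, ∀ y ∈ φ.target, ∀ i j k,
    pd i (comp2 S.F φ j k) y + pd j (comp2 S.F φ k i) y + pd k (comp2 S.F φ i j) y = 0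
  maxwell_star : ∀ φ ∈ IsManifold.maximalAtlas 𝓘(ℝ, Coord) ∞ M, ∀ y ∈ φ.target, ∀ i j k,
    pd i (S.starF φ j k) y + pd j (S.starF φ k i) y + pd k (S.starF φ i j) y = 0

/-- Components `(∇_i K)^k` of the covariant derivative of a vector field. -/
def nablaV (K : VField M) (φ : Chart M) (i k : Fin 4) (y : Coord) : ℝ :=
  pd i (vcomp K φ k) y + ∑ j, S.Gam φ k i j y * vcomp K φ j y

end EMSpacetime

section Horizon

variable {M : Type*} [TopologicalSpace M] [ChartedSpace Coord M]

/-- Components of the Lie derivative `L_K T` of a covariant 2-tensor. -/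
def lie2 (K : VField M) (T : Tensor2 M) (φ : Chart M) (i j : Fin 4) (y : Coord) : ℝ :=
  ∑ k, (vcomp K φ k y * pd k (comp2 T φ i j) y
    + comp2 T φ k j y * pd i (vcomp K φ k) y + comp2 T φ i k y * pd j (vcomp K φ k) y)

/-- `φ` is a smooth chart in which `H` is the zero set of the last coordinate. -/
def IsSliceChart (H : Set M) (φ : Chart M) : Prop :=
  φ ∈ IsManifold.maximalAtlas 𝓘(ℝ, Coord) ∞ M ∧ ∀ p ∈ φ.source, (p ∈ H ↔ φ p 3 = 0)

/-- `(H, K|_H)` is a Killing horizon: `H` is an embedded null hypersurface, and `K` is a smooth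
Killing field, leaving also the electromagnetic field invariant, which is tangent to `H` and null
on `H`. (No global product structure `H ≅ (compact surface) × (interval)` is required, and the
vanishing of the expansion of `H` follows from the Killing equation.) -/
structure IsKillingHorizon (S : EMSpacetime M) (H : Set M) (K : VField M) : Prop where
  hypersurface : ∀ p ∈ H, ∃ φ : Chart M, IsSliceChart H φ ∧ p ∈ φ.source
  /-- the metric induced on `H` is degenerate -/
  null_hypersurface : ∀ φ : Chart M, IsSliceChart H φ → ∀ y ∈ φ.target, y 3 = 0 →
    (Matrix.of fun i j : Fin 3 => comp2 S.g φ i.castSucc j.castSucc y).det = 0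
  K_smooth : ∀ φ ∈ IsManifold.maximalAtlas 𝓘(ℝ, Coord) ∞ M, ∀ i,
    ContDiffOn ℝ ∞ (vcomp K φ i) φ.target
  killing : ∀ φ ∈ IsManifold.maximalAtlas 𝓘(ℝ, Coord) ∞ M, ∀ y ∈ φ.target, ∀ i j,
    lie2 K S.g φ i j y = 0
  lie_F : ∀ φ ∈ IsManifold.maximalAtlas 𝓘(ℝ, Coord) ∞ M, ∀ y ∈ φ.target, ∀ i j,
    lie2 K S.F φ i j y = 0
  K_tangent : ∀ φ : Chart M, IsSliceChart H φ → ∀ y ∈ φ.target, y 3 = 0 → vcomp K φ 3 y = 0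
  K_null : ∀ p ∈ H, S.g p (K p) (K p) = 0

/-- `κ` is the surface gravity of `ℓ = K|_H`: `∇_ℓ ℓ = κ ℓ` on `H`. -/
def IsSurfaceGravity (S : EMSpacetime M) (H : Set M) (K : VField M) (κ : M → ℝ) : Prop :=
  ∀ φ ∈ IsManifold.maximalAtlas 𝓘(ℝ, Coord) ∞ M, ∀ y ∈ φ.target, φ.symm y ∈ H → ∀ k,
    ∑ i, vcomp K φ i y * S.nablaV K φ i k y = κ (φ.symm y) * vcomp K φ k y

/-- `φ = (x¹, x², v, r)` is a Bondi-like coordinate system of a neighbourhood of (a part of) `H`,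
adapted to `ℓ = K|_H`. -/
structure IsBondiChart (S : EMSpacetime M) (H : Set M) (K : VField M) (φ : Chart M) : Prop where
  /-- `H` is `{r = 0}` -/
  slice : IsSliceChart H φ
  /-- on `H`, `ℓ = ∂_v`: thus `ℓ(v) = 1`, and the `x^A` are constant along the null generators -/
  ell : ∀ y ∈ φ.target, y 3 = 0 → ∀ k, vcomp K φ k y = if k = 2 then 1 else 0
  /-- `n = -∂_r` is null -/
  n_null : ∀ y ∈ φ.target, comp2 S.g φ 3 3 y = 0
  /-- `n = -∂_r` is an affinely parametrized geodesic field: `∇_n n = 0` -/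
  n_geodesic : ∀ y ∈ φ.target, ∀ k, S.Gam φ k 3 3 y = 0
  /-- the pullback of `n_μ` to `H` is `-dv` -/
  n_pullback : ∀ y ∈ φ.target, y 3 = 0 → ∀ i : Fin 3,
    -comp2 S.g φ 3 i.castSucc y = if i = 2 then -1 else 0

/-- Scalar product `g(u, w)` of complex vectors with given components in the chart `φ`. -/
def gC (S : EMSpacetime M) (φ : Chart M) (y : Coord) (u w : Fin 4 → ℂ) : ℂ :=
  ∑ i, ∑ j, (comp2 S.g φ i j y : ℂ) * u i * w j

/-- `F(u, w)` for complex vectors with given components in the chart `φ`. -/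
def FC (S : EMSpacetime M) (φ : Chart M) (y : Coord) (u w : Fin 4 → ℂ) : ℂ :=
  ∑ i, ∑ j, (comp2 S.F φ i j y : ℂ) * u i * w j

/-- `e a y k` is the component `e_{a+1}^k` at the point with coordinates `y`, in the
Bondi-like chart `φ`, of the adapted null frame `(e₁, e₂, e₃, e₄) = (m, m̄, n, ℓ)`. -/
structure IsAdaptedFrame (S : EMSpacetime M) (φ : Chart M)
    (e : Fin 4 → Coord → Fin 4 → ℂ) : Prop where
  smooth : ∀ a k, ContDiffOn ℝ ∞ (fun y => e a y k) φ.target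
  conj_m : ∀ y ∈ φ.target, ∀ k, e 1 y k = starRingEnd ℂ (e 0 y k)
  /-- `n = -∂_r` -/
  n_eq : ∀ y ∈ φ.target, ∀ k, e 2 y k = if k = 3 then -1 else 0
  real_ell : ∀ y ∈ φ.target, ∀ k, (e 3 y k).im = 0
  /-- the only non-vanishing scalar products are `g(m, m̄) = 1`, `g(n, ℓ) = -1` -/
  products : ∀ y ∈ φ.target, ∀ a b, gC S φ y (e a y) (e b y) =
    !![0, 1, 0, 0; 1, 0, 0, 0; 0, 0, 0, -1; 0, 0, -1, 0] a b
  /-- on the horizon `r = 0`, `e₄ = ∂_v` -/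
  ell_horizon : ∀ y ∈ φ.target, y 3 = 0 → ∀ k, e 3 y k = if k = 2 then 1 else 0
  /-- on the horizon, `m` is tangent to the slices `v = const` -/
  m_tangent : ∀ y ∈ φ.target, y 3 = 0 → e 0 y 2 = 0 ∧ e 0 y 3 = 0
  /-- on the horizon, `m` is Lie dragged by `ℓ = ∂_v` -/
  m_dragged : ∀ y ∈ φ.target, y 3 = 0 → ∀ k, pd 2 (fun z => e 0 z k) y = 0
  /-- the frame is parallel along `n` -/
  parallel : ∀ y ∈ φ.target, ∀ a k, ∑ i, e 2 y i *
    (pd i (fun z => e a z k) y + ∑ j, (S.Gam φ k i j y : ℂ) * e a y j) = 0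
  /-- `(Re m, Im m, n, ℓ)` is positively oriented -/
  oriented : ∀ y ∈ φ.target, 0 < ∑ i, ∑ j, ∑ k, ∑ l, comp4 S.vol φ i j k l y *
    (e 0 y i).re * (e 0 y j).im * (e 2 y k).re * (e 3 y l).re

/-- Components `e^{a+1}_k` of the dual coframe. -/
def coframe (e : Fin 4 → Coord → Fin 4 → ℂ) (a k : Fin 4) (y : Coord) : ℂ :=
  (Matrix.of fun j b => e b y j)⁻¹ a k

/-- Maxwell scalars `Φ₀ = F₄₁`, `Φ₁ = (F₄₃ + F₂₁)/2`, `Φ₂ = F₂₃` of the frame `e`. -/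
def maxwellScalar (S : EMSpacetime M) (φ : Chart M) (e : Fin 4 → Coord → Fin 4 → ℂ)
    (I : Fin 3) (y : Coord) : ℂ :=
  ![FC S φ y (e 3 y) (e 0 y),
    (1 / 2 : ℂ) * (FC S φ y (e 3 y) (e 2 y) + FC S φ y (e 1 y) (e 0 y)),
    FC S φ y (e 1 y) (e 2 y)] I

/-- The point with coordinates `(x¹, x², v)` of the horizon `r = 0`. -/
def onHorizon (h : Fin 3 → ℝ) : Coord := ![h 0, h 1, h 2, 0]

/-- `rot` is the rotation 1-form potential of `ℓ = K|_H`, in the coordinates `(x¹, x², v)` of `H`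
that belong to a Bondi-like chart: `D_a ℓ^b = rot_a ℓ^b`. -/
def IsRotationForm (S : EMSpacetime M) (K : VField M) (φ : Chart M)
    (rot : (Fin 3 → ℝ) → Fin 3 → ℝ) : Prop :=
  ∀ h, onHorizon h ∈ φ.target → ∀ (a : Fin 3) (k : Fin 4),
    S.nablaV K φ a.castSucc k (onHorizon h) = rot h a * vcomp K φ k (onHorizon h)

/-- Components of the pullback to `H` of `F - i ⋆F`, in the coordinates `(x¹, x², v)`. -/
def pullbackF (S : EMSpacetime M) (φ : Chart M) (h : Fin 3 → ℝ) (a b : Fin 3) : ℂ :=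
  (comp2 S.F φ a.castSucc b.castSucc (onHorizon h) : ℂ)
    - Complex.I * (S.starF φ a.castSucc b.castSucc (onHorizon h) : ℂ)

/-- The radial derivative `∂_rⁿ f` at the point of `H` with coordinates `h`. -/
def radialDeriv (n : ℕ) (f : Coord → ℂ) (h : Fin 3 → ℝ) : ℂ :=
  iteratedDeriv n (fun r : ℝ => f ![h 0, h 1, h 2, r]) 0

end Horizon

end EMHorizon

end

open EMHorizon

/-! Indices 0 and 1 are the surface coordinates, written A, B below; 2 is v and 3 is r.

In Bondi-like coordinates the geodesic gauge gives g_rj = δ_jv off the horizon too, and the Killing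
equation then forces K = ∂_v there (`g_radial_of_bondi`, `killing_eq_pd_v`). What remains unknown is
g_AB, g_vA, g_vv and F_ij, all independent of v. No equation is solved: two solutions are compared,
and their Taylor coefficients in r at r = 0 are shown to agree by induction on the order.

The obstacle is that F_rA and ∂_r g_AB enter the components (A v r) of d⋆F = 0 and R_AB multiplied
by g^{rr}, which vanishes on the horizon. The non-zero surface gravity κ = -½ ∂_r g_vv makes this a
simple zero, since ∂_r g^{rr} = -∂_r g_vv there. If q has a simple zero, the k-th radial derivative
of ∂_r(q f) at r = 0 is (k+1) (∂_r q) ∂_r^k f plus terms in lower derivatives of f, so ∂_r(q f)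
determines f (`VanOn.of_transport`, `VanOn.of_pd_mul`). Hence stationarity removes the need to
prescribe F_rA and ∂_r g_AB on the horizon (`fieldJet_radial`, `metricJet_surface`). The remaining
equations give radial derivatives directly: R_rA and R_rv for g_vA and g_vv (`metricJet_null`),
Maxwell's equations for F_AB, F_vr and F_vA (`fieldJet_transport`). One round of these gains one
order in every component (`horizonBox_jets`).

The induction starts from the given data. The vector m fixes the whole frame, the metric and,
through the orientation, the volume form on the horizon. The rotation form is -½ ∂_r g_va. The
pullback of F - i⋆F gives F_AB and F_vr. Finally F_vA = 0 on the horizon, because Ric(ℓ,ℓ) = 0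
forces T(ℓ,ℓ) = 0 (`HorizonBox.ricci_null`, `HorizonBox.field_null`). With metric and field known to
all orders, parallel transport along n yields the frame (`jetAll_frame`), and coframe and Maxwell
scalars are polynomial in frame, metric and field. -/

noncomputable section

namespace EMHorizon

/-! ### Radial vanishing orders at r = 0, and the calculus of agreement to finite order -/

section RadialOrder

variable {𝕜 : Type*} [NormedField 𝕜] [NormedAlgebra ℝ 𝕜] {W : Set Coord}

theorem differentiableAt_of_contDiffOn {V : Type*} [NormedAddCommGroup V] [NormedSpace ℝ V]
    {f : Coord → V} (hW : IsOpen W) (hf : ContDiffOn ℝ ∞ f W) {y : Coord} (hy : y ∈ W) :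
    DifferentiableAt ℝ f y :=
  (hf.contDiffAt (hW.mem_nhds hy)).differentiableAt (by simp)

theorem contDiffOn_pd {f : Coord → 𝕜} (hW : IsOpen W) (hf : ContDiffOn ℝ ∞ f W) (i : Fin 4) :
    ContDiffOn ℝ ∞ (pd i f) W := by
  have h : ContDiffOn ℝ ∞ (fderiv ℝ f) W := hf.fderiv_of_isOpen hW (by simp)
  exact h.clm_apply contDiffOn_const

theorem pd_congr {V : Type*} [NormedAddCommGroup V] [NormedSpace ℝ V] {f g : Coord → V}
    (hW : IsOpen W) (h : Set.EqOn f g W) (i : Fin 4) : Set.EqOn (pd i f) (pd i g) W := by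
  intro y hy
  have : f =ᶠ[nhds y] g := Filter.eventuallyEq_of_mem (hW.mem_nhds hy) h
  simp only [pd, this.fderiv_eq]

theorem pd_eq_zero_of_const {V : Type*} [NormedAddCommGroup V] [NormedSpace ℝ V] {f : Coord → V}
    {c : V} (hW : IsOpen W) (h : ∀ y ∈ W, f y = c) (i : Fin 4) : ∀ y ∈ W, pd i f y = 0 := by
  intro y hy
  rw [pd_congr hW (g := fun _ => c) h i hy]
  simp [pd]

theorem pd_add {f g : Coord → 𝕜} (hW : IsOpen W) (hf : ContDiffOn ℝ ∞ f W)
    (hg : ContDiffOn ℝ ∞ g W) (i : Fin 4) {y : Coord} (hy : y ∈ W) :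
    pd i (fun z => f z + g z) y = pd i f y + pd i g y := by
  simp only [pd]
  rw [fderiv_fun_add (differentiableAt_of_contDiffOn hW hf hy)
    (differentiableAt_of_contDiffOn hW hg hy)]
  rfl

theorem pd_sub {f g : Coord → 𝕜} (hW : IsOpen W) (hf : ContDiffOn ℝ ∞ f W)
    (hg : ContDiffOn ℝ ∞ g W) (i : Fin 4) {y : Coord} (hy : y ∈ W) :
    pd i (fun z => f z - g z) y = pd i f y - pd i g y := by
  simp only [pd]
  rw [fderiv_fun_sub (differentiableAt_of_contDiffOn hW hf hy)
    (differentiableAt_of_contDiffOn hW hg hy)]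
  rfl

theorem pd_mul {f g : Coord → 𝕜} (hW : IsOpen W) (hf : ContDiffOn ℝ ∞ f W)
    (hg : ContDiffOn ℝ ∞ g W) (i : Fin 4) {y : Coord} (hy : y ∈ W) :
    pd i (fun z => f z * g z) y = pd i f y * g y + f y * pd i g y := by
  simp only [pd]
  rw [fderiv_fun_mul (differentiableAt_of_contDiffOn hW hf hy)
    (differentiableAt_of_contDiffOn hW hg hy)]
  simp only [add_apply, smul_apply, smul_eq_mul]
  ring

theorem pd_comm {f : Coord → 𝕜} (hW : IsOpen W) (hf : ContDiffOn ℝ ∞ f W) (i j : Fin 4)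
    {y : Coord} (hy : y ∈ W) : pd i (pd j f) y = pd j (pd i f) y := by
  have hfy := hf.contDiffAt (hW.mem_nhds hy)
  have hsym : IsSymmSndFDerivAt ℝ f y := hfy.isSymmSndFDerivAt (by
    rw [minSmoothness_of_isRCLikeNormedField]; exact WithTop.coe_le_coe.2 le_top)
  have hd : DifferentiableAt ℝ (fderiv ℝ f) y :=
    differentiableAt_of_contDiffOn hW (hf.fderiv_of_isOpen hW (by simp)) hy
  have key : ∀ a b : Fin 4, pd a (pd b f) y
      = fderiv ℝ (fderiv ℝ f) y (Pi.single a 1) (Pi.single b 1) := by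
    intro a b
    unfold pd
    rw [fderiv_clm_apply hd (differentiableAt_const _)]
    simp
  rw [key, key]
  exact hsym.eq _ _

/-- `VanOn W n f`: on `W`, the function `f` vanishes to order `n` in the radial coordinate at the
horizon, that is, `∂_rᵏ f = 0` at `r = 0` for all `k < n`. -/
def VanOn (W : Set Coord) : ℕ → (Coord → 𝕜) → Prop
  | 0, _ => True
  | n + 1, f => (∀ y ∈ W, y 3 = 0 → f y = 0) ∧ VanOn W n (pd 3 f)

theorem VanOn.congr (hW : IsOpen W) {n : ℕ} {f g : Coord → 𝕜} (h : VanOn W n f)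
    (hfg : Set.EqOn f g W) : VanOn W n g := by
  induction n generalizing f g with
  | zero => trivial
  | succ n ih =>
    exact ⟨fun y hy h3 => by rw [← hfg hy]; exact h.1 y hy h3, ih h.2 (pd_congr hW hfg 3)⟩

theorem VanOn.mono {m n : ℕ} {f : Coord → 𝕜} (h : VanOn W n f) (hmn : m ≤ n) : VanOn W m f := by
  induction m generalizing n f with
  | zero => trivial
  | succ m ih =>
    obtain ⟨k, rfl⟩ : ∃ k, n = k + 1 := ⟨n - 1, by omega⟩
    exact ⟨h.1, ih h.2 (by omega)⟩

theorem VanOn.eq_zero {n : ℕ} {f : Coord → 𝕜} (h : VanOn W n f) (hn : 1 ≤ n) {y : Coord}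
    (hy : y ∈ W) (h3 : y 3 = 0) : f y = 0 :=
  (h.mono hn).1 y hy h3

theorem VanOn.pd_three {n : ℕ} {f : Coord → 𝕜} (h : VanOn W n f) :
    VanOn W (n - 1) (pd 3 f) := by
  cases n with
  | zero => trivial
  | succ n => exact h.2

theorem VanOn.zero (hW : IsOpen W) (n : ℕ) {f : Coord → 𝕜} (h : ∀ y ∈ W, f y = 0) :
    VanOn W n f := by
  induction n generalizing f with
  | zero => trivial
  | succ n ih => exact ⟨fun y hy _ => h y hy, ih (pd_eq_zero_of_const hW h 3)⟩

theorem VanOn.add (hW : IsOpen W) {n : ℕ} {f g : Coord → 𝕜} (hf : VanOn W n f) (hg : VanOn W n g)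
    (sf : ContDiffOn ℝ ∞ f W) (sg : ContDiffOn ℝ ∞ g W) :
    VanOn W n (fun y => f y + g y) := by
  induction n generalizing f g with
  | zero => trivial
  | succ n ih =>
    refine ⟨fun y hy h3 => by simp [hf.1 y hy h3, hg.1 y hy h3], ?_⟩
    exact (ih hf.2 hg.2 (contDiffOn_pd hW sf 3) (contDiffOn_pd hW sg 3)).congr hW
      fun y hy => (pd_add hW sf sg 3 hy).symm

theorem VanOn.sub (hW : IsOpen W) {n : ℕ} {f g : Coord → 𝕜} (hf : VanOn W n f) (hg : VanOn W n g)
    (sf : ContDiffOn ℝ ∞ f W) (sg : ContDiffOn ℝ ∞ g W) :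
    VanOn W n (fun y => f y - g y) := by
  induction n generalizing f g with
  | zero => trivial
  | succ n ih =>
    refine ⟨fun y hy h3 => by simp [hf.1 y hy h3, hg.1 y hy h3], ?_⟩
    exact (ih hf.2 hg.2 (contDiffOn_pd hW sf 3) (contDiffOn_pd hW sg 3)).congr hW
      fun y hy => (pd_sub hW sf sg 3 hy).symm

theorem VanOn.mul (hW : IsOpen W) {a b : ℕ} {f g : Coord → 𝕜} (hf : VanOn W a f)
    (hg : VanOn W b g) (sf : ContDiffOn ℝ ∞ f W) (sg : ContDiffOn ℝ ∞ g W) :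
    VanOn W (a + b) (fun y => f y * g y) := by
  -- By Leibniz, each differentiation lowers either a or b, so the induction runs on the total
  -- order.
  obtain ⟨N, hN⟩ : ∃ N, N = a + b := ⟨_, rfl⟩
  rw [← hN]
  induction N generalizing a b f g with
  | zero => trivial
  | succ N ih =>
    refine ⟨fun y hy h3 => ?_, ?_⟩
    · rcases Nat.eq_zero_or_pos a with h | h
      · simp [hg.eq_zero (by omega) hy h3]
      · simp [hf.eq_zero h hy h3]
    · have s3f := contDiffOn_pd hW sf 3
      have s3g := contDiffOn_pd hW sg 3
      have h1 : VanOn W N (fun y => pd 3 f y * g y) := by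
        -- An order a = 0 cannot drop further; then b = N + 1, and one order of g is given up
        -- instead.
        rcases Nat.eq_zero_or_pos a with h | h
        · exact ih (a := 0) (b := N) trivial (hg.mono (by omega)) s3f sg (by omega)
        · exact ih hf.pd_three hg s3f sg (by omega)
      have h2 : VanOn W N (fun y => f y * pd 3 g y) := by
        rcases Nat.eq_zero_or_pos b with h | h
        · exact ih (a := N) (b := 0) (hf.mono (by omega)) trivial sf s3g (by omega)
        · exact ih hf hg.pd_three sf s3g (by omega)
      exact (h1.add hW h2 (s3f.mul sg) (sf.mul s3g)).congr hW
        fun y hy => (pd_mul hW sf sg 3 hy).symm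

theorem VanOn.mul_left (hW : IsOpen W) {n : ℕ} {f g : Coord → 𝕜} (hg : VanOn W n g)
    (sf : ContDiffOn ℝ ∞ f W) (sg : ContDiffOn ℝ ∞ g W) :
    VanOn W n (fun y => f y * g y) := by
  have := VanOn.mul hW (a := 0) (f := f) trivial hg sf sg
  simpa using this

/-- A line in a direction other than ∂_r that starts on {r = 0} stays on it, so f is constantly zero
along it near the point. -/
theorem pd_eq_zero_of_horizon {f : Coord → 𝕜} (hW : IsOpen W) (sf : ContDiffOn ℝ ∞ f W)
    (h : ∀ y ∈ W, y 3 = 0 → f y = 0) {i : Fin 4} (hi : i ≠ 3) {y : Coord} (hy : y ∈ W)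
    (h3 : y 3 = 0) : pd i f y = 0 := by
  have hd := (differentiableAt_of_contDiffOn hW sf hy).hasFDerivAt
  have hl := hd.hasLineDerivAt (Pi.single i (1 : ℝ))
  have hz : HasLineDerivAt ℝ f 0 y (Pi.single i (1 : ℝ)) := by
    have hev : (fun t : ℝ => f (y + t • (Pi.single i (1 : ℝ) : Coord))) =ᶠ[nhds 0] fun _ => 0 := by
      have hc : Continuous fun t : ℝ => y + t • (Pi.single i (1 : ℝ) : Coord) := by fun_prop
      have := hc.continuousAt.preimage_mem_nhds (x := (0 : ℝ)) (t := W)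
        (by simpa using hW.mem_nhds hy)
      filter_upwards [this] with t ht
      refine h _ ht ?_
      simp [h3, hi.symm]
    exact (hasDerivAt_const (0 : ℝ) (0 : 𝕜)).congr_of_eventuallyEq hev
  have := hl.unique hz
  simpa [pd] using this

theorem VanOn.pd_of_ne (hW : IsOpen W) {n : ℕ} {f : Coord → 𝕜} (hf : VanOn W n f)
    (sf : ContDiffOn ℝ ∞ f W) {i : Fin 4} (hi : i ≠ 3) : VanOn W n (pd i f) := by
  induction n generalizing f with
  | zero => trivial
  | succ n ih =>
    refine ⟨fun y hy h3 => pd_eq_zero_of_horizon hW sf hf.1 hi hy h3, ?_⟩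
    exact (ih hf.2 (contDiffOn_pd hW sf 3)).congr hW fun y hy => pd_comm hW sf i 3 hy

/-- A factor that does not vanish at the horizon can be cancelled. -/
theorem VanOn.of_mul_ne_zero (hW : IsOpen W) {n : ℕ} {q f : Coord → 𝕜}
    (sq : ContDiffOn ℝ ∞ q W) (sf : ContDiffOn ℝ ∞ f W) (hq : ∀ y ∈ W, y 3 = 0 → q y ≠ 0)
    (h : VanOn W n (fun y => q y * f y)) : VanOn W n f := by
  induction n generalizing f with
  | zero => trivial
  | succ n ih =>
    refine ⟨fun y hy h3 => (mul_eq_zero.1 (h.1 y hy h3)).resolve_left (hq y hy h3), ?_⟩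
    have hf := ih sf (h.mono (Nat.le_succ n))
    -- q ∂_r f = ∂_r(q f) - (∂_r q) f, where the last term already vanishes to order n by `hf`.
    have s3q := contDiffOn_pd hW sq 3
    have s3f := contDiffOn_pd hW sf 3
    refine ih s3f ?_
    refine (h.2.sub hW (hf.mul_left hW s3q sf) (contDiffOn_pd hW (sq.mul sf) 3)
      (s3q.mul sf)).congr hW fun y hy => ?_
    have := pd_mul hW sq sf 3 hy
    simp only [this]; ring

/-- At the horizon only (c+1) (∂_r q) f survives, which gives f = 0 there. Differentiating the
expression reproduces it for ∂_r f with c + 1 in place of c, up to (c+1) (∂_r² q) f, which the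
induction hypothesis controls. The free constant c is what makes the induction close, and it never
makes the coefficient vanish. -/
theorem VanOn.of_transport (hW : IsOpen W) [CharZero 𝕜] {n : ℕ} {q f : Coord → 𝕜} (c : ℕ)
    (sq : ContDiffOn ℝ ∞ q W) (sf : ContDiffOn ℝ ∞ f W) (hq0 : ∀ y ∈ W, y 3 = 0 → q y = 0)
    (hq : ∀ y ∈ W, y 3 = 0 → pd 3 q y ≠ 0)
    (h : VanOn W n (fun y => ((c + 1 : ℕ) : 𝕜) * (pd 3 q y * f y) + q y * pd 3 f y)) :
    VanOn W n f := by
  induction n generalizing f c with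
  | zero => trivial
  | succ n ih =>
    have hf := ih c sf (h.mono (Nat.le_succ n))
    have s3q := contDiffOn_pd hW sq 3
    have s3f := contDiffOn_pd hW sf 3
    have s33q := contDiffOn_pd hW s3q 3
    have s33f := contDiffOn_pd hW s3f 3
    have sc : ContDiffOn ℝ ∞ (fun _ : Coord => ((c + 1 : ℕ) : 𝕜)) W := contDiffOn_const
    refine ⟨fun y hy h3 => ?_, ?_⟩
    · have := h.1 y hy h3
      beta_reduce at this
      rw [hq0 y hy h3, zero_mul, add_zero] at this
      have h1 := (mul_eq_zero.1 this).resolve_left (Nat.cast_ne_zero.2 (Nat.succ_ne_zero c))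
      exact (mul_eq_zero.1 h1).resolve_left (hq y hy h3)
    · refine ih (c + 1) s3f ?_
      have h2 := (hf.mul_left hW s33q sf).mul_left hW sc (s33q.mul sf)
      refine (h.2.sub hW h2 (contDiffOn_pd hW ((sc.mul (s3q.mul sf)).add (sq.mul s3f)) 3)
        (sc.mul (s33q.mul sf))).congr hW fun y hy => ?_
      have e1 := pd_add hW (sc.mul (s3q.mul sf)) (sq.mul s3f) 3 hy
      have e2 := pd_mul hW sc (s3q.mul sf) 3 hy
      have e3 := pd_mul hW s3q sf 3 hy
      have e4 := pd_mul hW sq s3f 3 hy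
      have e5 : pd 3 (fun _ : Coord => ((c + 1 : ℕ) : 𝕜)) y = 0 := by simp [pd]
      simp only [e1, e2, e3, e4, e5]
      push_cast
      ring

/-- If `q` has a simple zero at the horizon, then the order of vanishing of `∂_r (q f)` is at most
that of `f`. -/
theorem VanOn.of_pd_mul (hW : IsOpen W) [CharZero 𝕜] {n : ℕ} {q f : Coord → 𝕜}
    (sq : ContDiffOn ℝ ∞ q W) (sf : ContDiffOn ℝ ∞ f W) (hq0 : ∀ y ∈ W, y 3 = 0 → q y = 0)
    (hq : ∀ y ∈ W, y 3 = 0 → pd 3 q y ≠ 0)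
    (h : VanOn W n (pd 3 (fun y => q y * f y))) : VanOn W n f := by
  refine VanOn.of_transport hW 0 sq sf hq0 hq (h.congr hW fun y hy => ?_)
  have := pd_mul hW sq sf 3 hy
  simp only [this]
  push_cast
  ring

theorem contDiffOn_inv {f : Coord → 𝕜} (sf : ContDiffOn ℝ ∞ f W) (h0 : ∀ y ∈ W, f y ≠ 0) :
    ContDiffOn ℝ ∞ (fun y => (f y)⁻¹) W := by
  intro y hy
  exact ContDiffWithinAt.inv (sf y hy) (h0 y hy)

/-- `Jet W n s f f'`: the smooth functions `f`, `f'` vanish to order `s.1` at the horizon, and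
their difference vanishes to order `n + s.2`. -/
structure Jet (W : Set Coord) (n : ℕ) (s : ℕ × ℕ) (f f' : Coord → 𝕜) : Prop where
  smooth : ContDiffOn ℝ ∞ f W
  smooth' : ContDiffOn ℝ ∞ f' W
  van : VanOn W s.1 f
  van' : VanOn W s.1 f'
  diff : VanOn W (n + s.2) (fun y => f y - f' y)

/-- The orders of a product. -/
def omul (s t : ℕ × ℕ) : ℕ × ℕ := (s.1 + t.1, min (s.2 + t.1) (s.1 + t.2))

/-- The orders of a sum over the four coordinates. -/
def osum (s : Fin 4 → ℕ × ℕ) : ℕ × ℕ := s 0 ⊓ s 1 ⊓ s 2 ⊓ s 3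

/-- The orders of a radial derivative. -/
def opred (s : ℕ × ℕ) : ℕ × ℕ := (s.1 - 1, s.2 - 1)

namespace Jet

variable {n : ℕ} {s t : ℕ × ℕ} {f f' g g' : Coord → 𝕜}

theorem mono (h : Jet W n s f f') (hts : t ≤ s) : Jet W n t f f' :=
  ⟨h.smooth, h.smooth', h.van.mono hts.1, h.van'.mono hts.1,
    h.diff.mono (Nat.add_le_add_left hts.2 n)⟩

theorem congr (hW : IsOpen W) (h : Jet W n s f f') (e : Set.EqOn f g W)
    (e' : Set.EqOn f' g' W) : Jet W n s g g' :=
  ⟨h.smooth.congr fun y hy => (e hy).symm, h.smooth'.congr fun y hy => (e' hy).symm,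
    h.van.congr hW e, h.van'.congr hW e',
    h.diff.congr hW fun y hy => by simp only [e hy, e' hy]⟩

/-- The 9 is a finite stand-in for infinity, larger than any order that the argument exploits. Using
a numeral keeps the comparisons between orders decidable. -/
theorem const (hW : IsOpen W) (n : ℕ) (c : 𝕜) : Jet W n (0, 9) (fun _ => c) (fun _ => c) :=
  ⟨contDiffOn_const, contDiffOn_const, trivial, trivial, VanOn.zero hW _ (by simp)⟩

theorem of_const (hW : IsOpen W) {c : 𝕜} (h : ∀ y ∈ W, f y = c) (h' : ∀ y ∈ W, f' y = c) :
    Jet W n (0, 9) f f' :=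
  (const hW n c).congr hW (fun y hy => (h y hy).symm) (fun y hy => (h' y hy).symm)

theorem of_zero (hW : IsOpen W) (h : ∀ y ∈ W, f y = 0) (h' : ∀ y ∈ W, f' y = 0) :
    Jet W n (9, 9) f f' :=
  Jet.congr hW (f := fun _ => 0) (f' := fun _ => 0)
    ⟨contDiffOn_const, contDiffOn_const, VanOn.zero hW _ (by simp), VanOn.zero hW _ (by simp),
      VanOn.zero hW _ (by simp)⟩
    (fun y hy => (h y hy).symm) (fun y hy => (h' y hy).symm)

theorem add (hW : IsOpen W) (hf : Jet W n s f f') (hg : Jet W n t g g') :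
    Jet W n (s ⊓ t) (fun y => f y + g y) (fun y => f' y + g' y) := by
  have h1 := hf.mono (inf_le_left : s ⊓ t ≤ s)
  have h2 := hg.mono (inf_le_right : s ⊓ t ≤ t)
  refine ⟨h1.smooth.add h2.smooth, h1.smooth'.add h2.smooth',
    h1.van.add hW h2.van h1.smooth h2.smooth, h1.van'.add hW h2.van' h1.smooth' h2.smooth', ?_⟩
  exact (h1.diff.add hW h2.diff (h1.smooth.sub h1.smooth') (h2.smooth.sub h2.smooth')).congr hW
    fun y _ => by ring

/-- f g - f' g' = (f - f') g + f' (g - g'). This is why vanishing orders are carried along: a zero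
of one factor at the horizon makes up for a missing order of agreement in the other. -/
theorem mul (hW : IsOpen W) (hf : Jet W n s f f') (hg : Jet W n t g g') :
    Jet W n (omul s t) (fun y => f y * g y) (fun y => f' y * g' y) := by
  refine ⟨hf.smooth.mul hg.smooth, hf.smooth'.mul hg.smooth',
    hf.van.mul hW hg.van hf.smooth hg.smooth, hf.van'.mul hW hg.van' hf.smooth' hg.smooth', ?_⟩
  have sdf := hf.smooth.sub hf.smooth'
  have sdg := hg.smooth.sub hg.smooth'
  have h1 := hf.diff.mul hW hg.van sdf hg.smooth
  have h2 := hf.van'.mul hW hg.diff hf.smooth' sdg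
  have e1 : n + (omul s t).2 ≤ n + s.2 + t.1 := by
    have : (omul s t).2 ≤ s.2 + t.1 := min_le_left _ _
    omega
  have e2 : n + (omul s t).2 ≤ s.1 + (n + t.2) := by
    have : (omul s t).2 ≤ s.1 + t.2 := min_le_right _ _
    omega
  exact ((h1.mono e1).add hW (h2.mono e2) (sdf.mul hg.smooth) (hf.smooth'.mul sdg)).congr hW
    fun y _ => by ring

theorem const_mul (hW : IsOpen W) (c : 𝕜) (hf : Jet W n s f f') :
    Jet W n s (fun y => c * f y) (fun y => c * f' y) := by
  have sc : ContDiffOn ℝ ∞ (fun _ : Coord => c) W := contDiffOn_const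
  refine ⟨sc.mul hf.smooth, sc.mul hf.smooth', hf.van.mul_left hW sc hf.smooth,
    hf.van'.mul_left hW sc hf.smooth', ?_⟩
  exact (hf.diff.mul_left hW sc (hf.smooth.sub hf.smooth')).congr hW fun y _ => by ring

theorem sub (hW : IsOpen W) (hf : Jet W n s f f') (hg : Jet W n t g g') :
    Jet W n (s ⊓ t) (fun y => f y - g y) (fun y => f' y - g' y) :=
  (hf.add hW (hg.const_mul hW (-1))).congr hW (fun y _ => by ring) (fun y _ => by ring)

theorem sum (hW : IsOpen W) {s : Fin 4 → ℕ × ℕ} {f f' : Fin 4 → Coord → 𝕜}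
    (h : ∀ i, Jet W n (s i) (f i) (f' i)) :
    Jet W n (osum s) (fun y => ∑ i, f i y) (fun y => ∑ i, f' i y) := by
  simp only [Fin.sum_univ_four]
  exact (((h 0).add hW (h 1)).add hW (h 2)).add hW (h 3)

theorem pd_of_ne (hW : IsOpen W) (hf : Jet W n s f f') {i : Fin 4} (hi : i ≠ 3) :
    Jet W n s (pd i f) (pd i f') :=
  ⟨contDiffOn_pd hW hf.smooth i, contDiffOn_pd hW hf.smooth' i,
    hf.van.pd_of_ne hW hf.smooth hi, hf.van'.pd_of_ne hW hf.smooth' hi,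
    (hf.diff.pd_of_ne hW (hf.smooth.sub hf.smooth') hi).congr hW
      fun _ hy => pd_sub hW hf.smooth hf.smooth' i hy⟩

theorem pd_three (hW : IsOpen W) (hf : Jet W n s f f') (hs : 1 ≤ s.2) :
    Jet W n (opred s) (pd 3 f) (pd 3 f') := by
  refine ⟨contDiffOn_pd hW hf.smooth 3, contDiffOn_pd hW hf.smooth' 3,
    hf.van.pd_three, hf.van'.pd_three, ?_⟩
  -- Subtraction is truncated: without 1 ≤ s.2 the left side could exceed the right.
  have e : n + (opred s).2 = n + s.2 - 1 := by simp only [opred]; omega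
  rw [e]
  exact hf.diff.pd_three.congr hW fun _ hy => pd_sub hW hf.smooth hf.smooth' 3 hy

theorem inv (hW : IsOpen W) (hf : Jet W n s f f') (h0 : ∀ y ∈ W, f y ≠ 0)
    (h0' : ∀ y ∈ W, f' y ≠ 0) :
    Jet W n (0, s.2) (fun y => (f y)⁻¹) (fun y => (f' y)⁻¹) := by
  have s1 := contDiffOn_inv hf.smooth h0
  have s2 := contDiffOn_inv hf.smooth' h0'
  refine ⟨s1, s2, trivial, trivial, ?_⟩
  have sm : ContDiffOn ℝ ∞ (fun y => -((f y)⁻¹ * (f' y)⁻¹)) W := (s1.mul s2).neg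
  refine (hf.diff.mul_left hW sm (hf.smooth.sub hf.smooth')).congr hW fun y hy => ?_
  have := h0 y hy
  have := h0' y hy
  field_simp
  ring

/-- Functions with the same values at the horizon, whose radial derivatives agree to order `n + k`,
agree to order `n + k + 1`. -/
theorem of_pd_three (hW : IsOpen W) {k : ℕ} (hf : Jet W n (s.1, 1) f f')
    (hd : VanOn W (n + k) (fun y => pd 3 f y - pd 3 f' y)) :
    Jet W n (s.1, k + 1) f f' := by
  refine ⟨hf.smooth, hf.smooth', hf.van, hf.van', ?_⟩
  refine ⟨fun y hy h3 => hf.diff.eq_zero (by simp) hy h3, ?_⟩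
  exact hd.congr hW fun y hy => (pd_sub hW hf.smooth hf.smooth' 3 hy).symm

end Jet

end RadialOrder

/-! ### The equations of a horizon in adapted coordinates, and independence of v -/

section Box

variable {M : Type*} [TopologicalSpace M] [ChartedSpace Coord M]

/-- The Levi-Civita symbol on the indices `0, 1, 2, 3`. -/
def leviCivita (i j k l : Fin 4) : ℤ :=
  ((j.val : ℤ) - i.val) * ((k.val : ℤ) - i.val) * ((l.val : ℤ) - i.val) * ((k.val : ℤ) - j.val)
    * ((l.val : ℤ) - j.val) * ((l.val : ℤ) - k.val) / 12

/-- Determinant of the metric induced on the surfaces of constant `(v, r)`. -/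
def areaDet (S : EMSpacetime M) (φ : Chart M) (y : Coord) : ℝ :=
  comp2 S.g φ 0 0 y * comp2 S.g φ 1 1 y - comp2 S.g φ 0 1 y * comp2 S.g φ 0 1 y

/-- The coordinate form of an electrovac Killing horizon in a Bondi-like chart, on an open set `W`
of coordinate values. -/
structure HorizonBox (S : EMSpacetime M) (φ : Chart M) (κ₀ Λ : ℝ) (W : Set Coord) : Prop where
  isOpen : IsOpen W
  g_smooth : ∀ i j, ContDiffOn ℝ ∞ (comp2 S.g φ i j) W
  F_smooth : ∀ i j, ContDiffOn ℝ ∞ (comp2 S.F φ i j) W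
  vol_smooth : ContDiffOn ℝ ∞ (comp4 S.vol φ 0 1 2 3) W
  g_symm : ∀ i j, comp2 S.g φ i j = comp2 S.g φ j i
  F_antisymm : ∀ i j y, comp2 S.F φ i j y = -comp2 S.F φ j i y
  g_radial : ∀ j, ∀ y ∈ W, comp2 S.g φ 3 j y = if j = 2 then 1 else 0
  g_stat : ∀ i j, ∀ y ∈ W, pd 2 (comp2 S.g φ i j) y = 0
  F_stat : ∀ i j, ∀ y ∈ W, pd 2 (comp2 S.F φ i j) y = 0
  vol_comp : ∀ i j k l y, comp4 S.vol φ i j k l y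
    = (leviCivita i j k l : ℝ) * comp4 S.vol φ 0 1 2 3 y
  vol_sq : ∀ y ∈ W, comp4 S.vol φ 0 1 2 3 y * comp4 S.vol φ 0 1 2 3 y = areaDet S φ y
  areaDet_ne : ∀ y ∈ W, areaDet S φ y ≠ 0
  ricci_eq : ∀ i j, ∀ y ∈ W, S.ricci φ i j y = Λ * comp2 S.g φ i j y + κ₀ * S.stress φ i j y
  maxwell : ∀ i j k, ∀ y ∈ W,
    pd i (comp2 S.F φ j k) y + pd j (comp2 S.F φ k i) y + pd k (comp2 S.F φ i j) y = 0
  maxwell_star : ∀ i j k, ∀ y ∈ W,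
    pd i (S.starF φ j k) y + pd j (S.starF φ k i) y + pd k (S.starF φ i j) y = 0
  g_null : ∀ y ∈ W, y 3 = 0 → ∀ j, j ≠ 3 → comp2 S.g φ 2 j y = 0
  surfaceGravity_ne : ∀ y ∈ W, y 3 = 0 → pd 3 (comp2 S.g φ 2 2) y ≠ 0

/-- Smooth functions on `W` that do not depend on `v`. -/
def Stat (W : Set Coord) (f : Coord → ℝ) : Prop :=
  ContDiffOn ℝ ∞ f W ∧ ∀ y ∈ W, pd 2 f y = 0

section Stat

variable {W : Set Coord} {f g : Coord → ℝ}

theorem Stat.add (hW : IsOpen W) (hf : Stat W f) (hg : Stat W g) : Stat W fun y => f y + g y :=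
  ⟨hf.1.add hg.1, fun y hy => by rw [pd_add hW hf.1 hg.1 2 hy, hf.2 y hy, hg.2 y hy, add_zero]⟩

theorem Stat.mul (hW : IsOpen W) (hf : Stat W f) (hg : Stat W g) : Stat W fun y => f y * g y :=
  ⟨hf.1.mul hg.1, fun y hy => by rw [pd_mul hW hf.1 hg.1 2 hy, hf.2 y hy, hg.2 y hy]; ring⟩

theorem Stat.const (c : ℝ) : Stat W fun _ => c := ⟨contDiffOn_const, fun y _ => by simp [pd]⟩

theorem Stat.congr (hW : IsOpen W) (hf : Stat W f) (h : Set.EqOn f g W) : Stat W g :=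
  ⟨hf.1.congr fun y hy => (h hy).symm, fun y hy => by rw [← pd_congr hW h 2 hy, hf.2 y hy]⟩

theorem Stat.sub (hW : IsOpen W) (hf : Stat W f) (hg : Stat W g) : Stat W fun y => f y - g y :=
  (hf.add hW ((Stat.const (-1)).mul hW hg)).congr hW fun y _ => by ring

theorem Stat.inv (hW : IsOpen W) (hf : Stat W f) (h0 : ∀ y ∈ W, f y ≠ 0) :
    Stat W fun y => (f y)⁻¹ := by
  have hs := contDiffOn_inv hf.1 h0
  refine ⟨hs, fun y hy => ?_⟩
  have h1 : pd 2 (fun y => f y * (f y)⁻¹) y = 0 :=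
    pd_eq_zero_of_const hW (c := (1 : ℝ)) (fun z hz => mul_inv_cancel₀ (h0 z hz)) 2 y hy
  rw [pd_mul hW hf.1 hs 2 hy, hf.2 y hy, zero_mul, zero_add] at h1
  exact (mul_eq_zero.1 h1).resolve_left (h0 y hy)

theorem Stat.pd (hW : IsOpen W) (hf : Stat W f) (i : Fin 4) : Stat W (pd i f) :=
  ⟨contDiffOn_pd hW hf.1 i, fun y hy => by
    rw [pd_comm hW hf.1 2 i hy]; exact pd_eq_zero_of_const hW hf.2 i y hy⟩

theorem Stat.sum (hW : IsOpen W) {f : Fin 4 → Coord → ℝ} (h : ∀ i, Stat W (f i)) :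
    Stat W fun y => ∑ i, f i y := by
  simp only [Fin.sum_univ_four]
  exact (((h 0).add hW (h 1)).add hW (h 2)).add hW (h 3)

end Stat

namespace HorizonBox

variable {S : EMSpacetime M} {φ : Chart M} {κ₀ Λ : ℝ} {W : Set Coord}

theorem g_radial' (B : HorizonBox S φ κ₀ Λ W) (j : Fin 4) :
    ∀ y ∈ W, comp2 S.g φ j 3 y = if j = 2 then 1 else 0 := by
  rw [B.g_symm j 3]; exact B.g_radial j

/-- Since the r-row of the metric is (0, 0, 1, 0), only the surface block has to be inverted. The
v-row of the inverse is (0, 0, 0, 1), and g^{rA}, g^{rr} are built from g_vA, g_vv, so they inherit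
their zeros on the horizon. -/
theorem ginv_eq (B : HorizonBox S φ κ₀ Λ W) {y : Coord} (hy : y ∈ W) :
    ∀ i j, S.ginv φ i j y =
      (let g := fun i j => comp2 S.g φ i j y
       let a := g 1 1 * (areaDet S φ y)⁻¹
       let b := -1 * (g 0 1 * (areaDet S φ y)⁻¹)
       let c := g 0 0 * (areaDet S φ y)⁻¹
       let u := -1 * (a * g 0 2 + b * g 1 2)
       let v := -1 * (b * g 0 2 + c * g 1 2)
       !![a, b, 0, u; b, c, 0, v; 0, 0, 0, 1; u, v, 1, -1 * (g 2 2 + (u * g 0 2 + v * g 1 2))]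
        i j) := by
  intro i j
  unfold EMSpacetime.ginv
  dsimp only
  refine congrFun (congrFun (Matrix.inv_eq_right_inv (A := Matrix.of fun a b =>
    comp2 S.g φ a b y) ?_) i) j
  have hd := B.areaDet_ne y hy
  have r := fun j => B.g_radial j y hy
  have r' := fun j => B.g_radial' j y hy
  have e10 : comp2 S.g φ 1 0 y = comp2 S.g φ 0 1 y := by rw [B.g_symm]
  have e20 : comp2 S.g φ 2 0 y = comp2 S.g φ 0 2 y := by rw [B.g_symm]
  have e21 : comp2 S.g φ 2 1 y = comp2 S.g φ 1 2 y := by rw [B.g_symm]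
  ext i j
  fin_cases i <;> fin_cases j <;>
    simp [Matrix.mul_apply, Fin.sum_univ_four, r, r', e10, e20, e21] <;>
    (try field_simp) <;> simp only [areaDet] <;> ring

theorem stat_g (B : HorizonBox S φ κ₀ Λ W) (i j : Fin 4) : Stat W (comp2 S.g φ i j) :=
  ⟨B.g_smooth i j, B.g_stat i j⟩

theorem stat_areaDet_inv (B : HorizonBox S φ κ₀ Λ W) : Stat W fun y => (areaDet S φ y)⁻¹ := by
  have hW := B.isOpen
  exact ((((B.stat_g 0 0).mul hW (B.stat_g 1 1)).sub hW
    ((B.stat_g 0 1).mul hW (B.stat_g 0 1)))).inv hW B.areaDet_ne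

theorem stat_ginv (B : HorizonBox S φ κ₀ Λ W) (i j : Fin 4) : Stat W (S.ginv φ i j) := by
  have hW := B.isOpen
  have G := B.stat_g
  have D := B.stat_areaDet_inv
  have m1 := Stat.const (W := W) (-1)
  have a := (G 1 1).mul hW D
  have b := m1.mul hW ((G 0 1).mul hW D)
  have c := (G 0 0).mul hW D
  have u := m1.mul hW ((a.mul hW (G 0 2)).add hW (b.mul hW (G 1 2)))
  have v := m1.mul hW ((b.mul hW (G 0 2)).add hW (c.mul hW (G 1 2)))
  have w := m1.mul hW ((G 2 2).add hW ((u.mul hW (G 0 2)).add hW (v.mul hW (G 1 2))))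
  have z := Stat.const (W := W) 0
  have o := Stat.const (W := W) 1
  fin_cases i <;> fin_cases j
  · exact a.congr hW fun y hy => (B.ginv_eq hy 0 0).symm
  · exact b.congr hW fun y hy => (B.ginv_eq hy 0 1).symm
  · exact z.congr hW fun y hy => (B.ginv_eq hy 0 2).symm
  · exact u.congr hW fun y hy => (B.ginv_eq hy 0 3).symm
  · exact b.congr hW fun y hy => (B.ginv_eq hy 1 0).symm
  · exact c.congr hW fun y hy => (B.ginv_eq hy 1 1).symm
  · exact z.congr hW fun y hy => (B.ginv_eq hy 1 2).symm
  · exact v.congr hW fun y hy => (B.ginv_eq hy 1 3).symm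
  · exact z.congr hW fun y hy => (B.ginv_eq hy 2 0).symm
  · exact z.congr hW fun y hy => (B.ginv_eq hy 2 1).symm
  · exact z.congr hW fun y hy => (B.ginv_eq hy 2 2).symm
  · exact o.congr hW fun y hy => (B.ginv_eq hy 2 3).symm
  · exact u.congr hW fun y hy => (B.ginv_eq hy 3 0).symm
  · exact v.congr hW fun y hy => (B.ginv_eq hy 3 1).symm
  · exact o.congr hW fun y hy => (B.ginv_eq hy 3 2).symm
  · exact w.congr hW fun y hy => (B.ginv_eq hy 3 3).symm

theorem stat_Gam (B : HorizonBox S φ κ₀ Λ W) (k i j : Fin 4) : Stat W (S.Gam φ k i j) := by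
  have hW := B.isOpen
  unfold EMSpacetime.Gam
  refine (Stat.const (1 / 2)).mul hW (Stat.sum hW fun l => (B.stat_ginv k l).mul hW ?_)
  exact (((B.stat_g j l).pd hW i).add hW ((B.stat_g i l).pd hW j)).sub hW ((B.stat_g i j).pd hW l)

theorem ginv_symm (B : HorizonBox S φ κ₀ Λ W) (i j : Fin 4) {y : Coord} (hy : y ∈ W) :
    S.ginv φ i j y = S.ginv φ j i y := by
  rw [B.ginv_eq hy, B.ginv_eq hy]
  fin_cases i <;> fin_cases j <;> rfl

/-- `Γ^k_{kv} = ∂_v log √(-det g) = 0`. -/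
theorem sum_Gam_two (B : HorizonBox S φ κ₀ Λ W) {y : Coord} (hy : y ∈ W) :
    ∑ k, S.Gam φ k k 2 y = 0 := by
  have h : ∑ k, S.Gam φ k k 2 y = (1 / 2) * ((∑ k, ∑ l, S.ginv φ k l y *
      pd k (comp2 S.g φ 2 l) y) - ∑ k, ∑ l, S.ginv φ k l y * pd l (comp2 S.g φ 2 k) y) := by
    simp only [EMSpacetime.Gam, ← Finset.mul_sum, B.g_stat _ _ y hy, add_zero, mul_sub,
      Finset.sum_sub_distrib]
    simp only [B.g_symm _ 2]
  rw [h, Finset.sum_comm]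
  rw [sub_eq_zero.2, mul_zero]
  exact Finset.sum_congr rfl fun l _ => Finset.sum_congr rfl fun k _ => by
    rw [B.ginv_symm k l hy]

end HorizonBox

end Box

/-! ### Order tables for metric, connection, curvature and field -/

section Orders

/-- Orders of the metric components. -/
def oMetric (p q s : ℕ) : Fin 4 → Fin 4 → ℕ × ℕ :=
  ![![(0, p), (0, p), (1, q), (9, 9)],
    ![(0, p), (0, p), (1, q), (9, 9)],
    ![(1, q), (1, q), (1, s), (0, 9)],
    ![(9, 9), (9, 9), (0, 9), (9, 9)]]

/-- Orders of the components of the inverse metric. -/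
def oInv (p q s : ℕ) : Fin 4 → Fin 4 → ℕ × ℕ :=
  let m := min (p + 1) q
  ![![(0, p), (0, p), (9, 9), (1, m)],
    ![(0, p), (0, p), (9, 9), (1, m)],
    ![(9, 9), (9, 9), (9, 9), (0, 9)],
    ![(1, m), (1, m), (0, 9), (1, min s m)]]

/-- Orders of the derivatives `∂_l g_ij` of the metric components. -/
def oDeriv (p q s : ℕ) (l i j : Fin 4) : ℕ × ℕ :=
  if l = 2 ∨ i = 3 ∨ j = 3 then (9, 9)
  else if l = 3 then opred (oMetric p q s i j) else oMetric p q s i j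

/-- Orders of twice the Christoffel symbols of the first kind. -/
def oChrist (p q s : ℕ) (i j l : Fin 4) : ℕ × ℕ :=
  (oDeriv p q s i j l ⊓ oDeriv p q s j i l) ⊓ oDeriv p q s l i j

/-- Orders of the Christoffel symbols. -/
def oGam (p q s : ℕ) (k i j : Fin 4) : ℕ × ℕ :=
  osum fun l => omul (oInv p q s k l) (oChrist p q s i j l)

/-- Orders of the derivative along `∂_i` of a function that does not depend on `v`. -/
def oPd (i : Fin 4) (s : ℕ × ℕ) : ℕ × ℕ := if i = 2 then (9, 9) else if i = 3 then opred s else s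

/-- Orders of the traces `Γ^k_{kl}` of the Christoffel symbols. -/
def oTrace (p q s : ℕ) (l : Fin 4) : ℕ × ℕ :=
  if l = 2 then (9, 9) else osum fun k => oGam p q s k k l

/-- Orders of the quadratic terms in the Ricci tensor. -/
def oQuad (p q s : ℕ) (i j : Fin 4) : ℕ × ℕ :=
  (osum fun l => omul (oTrace p q s l) (oGam p q s l i j)) ⊓
    osum fun k => osum fun l => omul (oGam p q s k j l) (oGam p q s l i k)

/-- Orders of the components of the field tensor. -/
def oField (u x z c : ℕ) : Fin 4 → Fin 4 → ℕ × ℕ :=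
  ![![(9, 9), (0, u), (1, z), (0, c)],
    ![(0, u), (9, 9), (1, z), (0, c)],
    ![(1, z), (1, z), (9, 9), (0, x)],
    ![(0, c), (0, c), (0, x), (9, 9)]]

/-- Orders of the components of the volume form. -/
def oVol (p : ℕ) (i j k l : Fin 4) : ℕ × ℕ := if leviCivita i j k l = 0 then (9, 9) else (0, p)

/-- Orders of the components of the dual field tensor. -/
def oStar (p q s u x z c : ℕ) (i j : Fin 4) : ℕ × ℕ :=
  osum fun k => osum fun l => osum fun a => osum fun b =>
    omul (omul (omul (oVol p i j k l) (oInv p q s k a)) (oInv p q s l b)) (oField u x z c a b)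

end Orders

/-! ### Agreement of all derived quantities according to the order tables -/

section Comparison

variable {M M' : Type*} [TopologicalSpace M] [ChartedSpace Coord M] [TopologicalSpace M']
  [ChartedSpace Coord M'] {S : EMSpacetime M} {S' : EMSpacetime M'} {φ : Chart M} {φ' : Chart M'}
  {κ₀ Λ : ℝ} {W : Set Coord} {n p q s u x z c : ℕ}

/-- The metric components agree, with orders `p`, `q`, `s` for `g_AB`, `g_vA`, `g_vv`. -/
def MetricJet (S : EMSpacetime M) (S' : EMSpacetime M') (φ : Chart M) (φ' : Chart M')
    (W : Set Coord) (n p q s : ℕ) : Prop :=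
  ∀ i j, Jet W n (oMetric p q s i j) (comp2 S.g φ i j) (comp2 S'.g φ' i j)

/-- The field components agree, with orders `u`, `x`, `z`, `c` for `F_AB`, `F_vr`, `F_vA`,
`F_rA`. -/
def FieldJet (S : EMSpacetime M) (S' : EMSpacetime M') (φ : Chart M) (φ' : Chart M')
    (W : Set Coord) (n u x z c : ℕ) : Prop :=
  ∀ i j, Jet W n (oField u x z c i j) (comp2 S.F φ i j) (comp2 S'.F φ' i j)

/-- The components with an index r are fixed by the gauge and carry no information. -/
theorem metricJet_of_ne (B : HorizonBox S φ κ₀ Λ W) (B' : HorizonBox S' φ' κ₀ Λ W)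
    (h : ∀ i j, i ≠ 3 → j ≠ 3 → Jet W n (oMetric p q s i j) (comp2 S.g φ i j) (comp2 S'.g φ' i j)) :
    MetricJet S S' φ φ' W n p q s := by
  intro i j
  have hW := B.isOpen
  have key : ∀ j, Jet W n (oMetric p q s 3 j) (comp2 S.g φ 3 j) (comp2 S'.g φ' 3 j) := by
    intro j
    have e := B.g_radial j
    have e' := B'.g_radial j
    fin_cases j
    · exact Jet.of_zero hW e e'
    · exact Jet.of_zero hW e e'
    · exact Jet.of_const hW e e'
    · exact Jet.of_zero hW e e'
  by_cases hi : i = 3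
  · subst hi; exact key j
  by_cases hj : j = 3
  · subst hj
    rw [B.g_symm, B'.g_symm]
    refine (key i).mono (le_of_eq ?_)
    fin_cases i <;> rfl
  exact h i j hi hj

theorem fieldJet_of_ne (B : HorizonBox S φ κ₀ Λ W) (B' : HorizonBox S' φ' κ₀ Λ W)
    (h : ∀ i j, i < j → Jet W n (oField u x z c i j) (comp2 S.F φ i j) (comp2 S'.F φ' i j)) :
    FieldJet S S' φ φ' W n u x z c := by
  intro i j
  have hW := B.isOpen
  rcases lt_trichotomy i j with hij | rfl | hij
  · exact h i j hij
  · refine (Jet.of_zero hW (fun y _ => ?_) (fun y _ => ?_)).mono (t := oField u x z c i i) ?_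
    · have := B.F_antisymm i i y; linarith
    · have := B'.F_antisymm i i y; linarith
    · fin_cases i <;> exact le_refl ((9, 9) : ℕ × ℕ)
  · refine (((h j i hij).const_mul hW (-1)).congr hW (fun y _ => ?_) (fun y _ => ?_)).mono
      (le_of_eq ?_)
    · simp only [B.F_antisymm i j y]; ring
    · simp only [B'.F_antisymm i j y]; ring
    · fin_cases i <;> fin_cases j <;> rfl

theorem jet_ginv (B : HorizonBox S φ κ₀ Λ W) (B' : HorizonBox S' φ' κ₀ Λ W)
    (G : MetricJet S S' φ φ' W n p q s) (i j : Fin 4) :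
    Jet W n (oInv p q s i j) (S.ginv φ i j) (S'.ginv φ' i j) := by
  have hW := B.isOpen
  have g00 : Jet W n (0, p) _ _ := G 0 0
  have g01 : Jet W n (0, p) _ _ := G 0 1
  have g11 : Jet W n (0, p) _ _ := G 1 1
  have g02 : Jet W n (1, q) _ _ := G 0 2
  have g12 : Jet W n (1, q) _ _ := G 1 2
  have g22 : Jet W n (1, s) _ _ := G 2 2
  have D : Jet W n (0, p) (fun y => (areaDet S φ y)⁻¹) (fun y => (areaDet S' φ' y)⁻¹) := by
    refine (Jet.inv (s := (0, p)) hW ?_ B.areaDet_ne B'.areaDet_ne)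
    exact (((g00.mul hW g11).sub hW (g01.mul hW g01))).mono (by simp [omul])
  have a := (g11.mul hW D).mono (t := (0, p)) (by simp [omul])
  have b := ((g01.mul hW D).const_mul hW (-1)).mono (t := (0, p)) (by simp [omul])
  have c := (g00.mul hW D).mono (t := (0, p)) (by simp [omul])
  -- g^{rA} = -g^{AB} g_vB, and g_vB vanishes at the horizon, so agreement of g^{AB} to order p
  -- counts here as p + 1.
  have u := (((a.mul hW g02).add hW (b.mul hW g12)).const_mul hW (-1)).mono
    (t := (1, min (p + 1) q)) (by simp [omul])
  have v := (((b.mul hW g02).add hW (c.mul hW g12)).const_mul hW (-1)).mono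
    (t := (1, min (p + 1) q)) (by simp [omul])
  have w := ((g22.add hW ((u.mul hW g02).add hW (v.mul hW g12))).const_mul hW (-1)).mono
    (t := (1, min s (min (p + 1) q))) (by
      simp only [omul, Prod.mk_inf_mk, Prod.mk_le_mk]
      constructor <;> omega)
  have e := fun y hy i j => (B.ginv_eq (y := y) hy i j).symm
  have e' := fun y hy i j => (B'.ginv_eq (y := y) hy i j).symm
  have zero : ∀ i j, (∀ y ∈ W, S.ginv φ i j y = 0) → (∀ y ∈ W, S'.ginv φ' i j y = 0) →
    Jet W n (9, 9) (S.ginv φ i j) (S'.ginv φ' i j) := fun i j => Jet.of_zero hW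
  fin_cases i <;> fin_cases j
  · exact a.congr hW (fun y hy => e y hy 0 0) (fun y hy => e' y hy 0 0)
  · exact b.congr hW (fun y hy => e y hy 0 1) (fun y hy => e' y hy 0 1)
  · exact zero 0 2 (fun y hy => B.ginv_eq hy 0 2) (fun y hy => B'.ginv_eq hy 0 2)
  · exact u.congr hW (fun y hy => e y hy 0 3) (fun y hy => e' y hy 0 3)
  · exact b.congr hW (fun y hy => e y hy 1 0) (fun y hy => e' y hy 1 0)
  · exact c.congr hW (fun y hy => e y hy 1 1) (fun y hy => e' y hy 1 1)
  · exact zero 1 2 (fun y hy => B.ginv_eq hy 1 2) (fun y hy => B'.ginv_eq hy 1 2)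
  · exact v.congr hW (fun y hy => e y hy 1 3) (fun y hy => e' y hy 1 3)
  · exact zero 2 0 (fun y hy => B.ginv_eq hy 2 0) (fun y hy => B'.ginv_eq hy 2 0)
  · exact zero 2 1 (fun y hy => B.ginv_eq hy 2 1) (fun y hy => B'.ginv_eq hy 2 1)
  · exact zero 2 2 (fun y hy => B.ginv_eq hy 2 2) (fun y hy => B'.ginv_eq hy 2 2)
  · exact Jet.of_const hW (c := 1) (fun y hy => B.ginv_eq hy 2 3) (fun y hy => B'.ginv_eq hy 2 3)
  · exact u.congr hW (fun y hy => e y hy 3 0) (fun y hy => e' y hy 3 0)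
  · exact v.congr hW (fun y hy => e y hy 3 1) (fun y hy => e' y hy 3 1)
  · exact Jet.of_const hW (c := 1) (fun y hy => B.ginv_eq hy 3 2) (fun y hy => B'.ginv_eq hy 3 2)
  · exact w.congr hW (fun y hy => e y hy 3 3) (fun y hy => e' y hy 3 3)

theorem jet_pd_metric (B : HorizonBox S φ κ₀ Λ W) (B' : HorizonBox S' φ' κ₀ Λ W)
    (hp : 1 ≤ p) (hq : 1 ≤ q) (hs : 1 ≤ s)
    (G : MetricJet S S' φ φ' W n p q s) (l i j : Fin 4) :
    Jet W n (oDeriv p q s l i j) (pd l (comp2 S.g φ i j)) (pd l (comp2 S'.g φ' i j)) := by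
  have hW := B.isOpen
  unfold oDeriv
  split_ifs with h1 h2
  · rcases h1 with rfl | rfl | rfl
    · exact Jet.of_zero hW (B.g_stat i j) (B'.g_stat i j)
    · exact Jet.of_zero hW (pd_eq_zero_of_const hW (B.g_radial j) l)
        (pd_eq_zero_of_const hW (B'.g_radial j) l)
    · exact Jet.of_zero hW (pd_eq_zero_of_const hW (B.g_radial' i) l)
        (pd_eq_zero_of_const hW (B'.g_radial' i) l)
  · subst h2
    refine (G i j).pd_three hW ?_
    fin_cases i <;> fin_cases j <;> first | assumption | (show 1 ≤ 9; norm_num)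
  · exact (G i j).pd_of_ne hW h2

theorem jet_christ (B : HorizonBox S φ κ₀ Λ W) (B' : HorizonBox S' φ' κ₀ Λ W)
    (hp : 1 ≤ p) (hq : 1 ≤ q) (hs : 1 ≤ s)
    (G : MetricJet S S' φ φ' W n p q s) (i j l : Fin 4) :
    Jet W n (oChrist p q s i j l)
      (fun y => pd i (comp2 S.g φ j l) y + pd j (comp2 S.g φ i l) y - pd l (comp2 S.g φ i j) y)
      (fun y => pd i (comp2 S'.g φ' j l) y + pd j (comp2 S'.g φ' i l) y
        - pd l (comp2 S'.g φ' i j) y) := by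
  have hW := B.isOpen
  have D := jet_pd_metric B B' hp hq hs G
  exact ((D i j l).add hW (D j i l)).sub hW (D l i j)

theorem jet_Gam (B : HorizonBox S φ κ₀ Λ W) (B' : HorizonBox S' φ' κ₀ Λ W)
    (hp : 1 ≤ p) (hq : 1 ≤ q) (hs : 1 ≤ s)
    (G : MetricJet S S' φ φ' W n p q s) (k i j : Fin 4) :
    Jet W n (oGam p q s k i j) (S.Gam φ k i j) (S'.Gam φ' k i j) := by
  have hW := B.isOpen
  exact (Jet.sum hW fun l => (jet_ginv B B' G k l).mul hW
    (jet_christ B B' hp hq hs G i j l)).const_mul hW (1 / 2)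

/-- The case l = v has to be treated through the whole sum: Γ^v_vv and Γ^r_rv do not vanish on the
horizon and only cancel each other. In R_AB this trace multiplies Γ^v_AB = -½ ∂_r g_AB, whose
agreement is one order short before `metricJet_surface`. -/
theorem jet_trace (B : HorizonBox S φ κ₀ Λ W) (B' : HorizonBox S' φ' κ₀ Λ W)
    (hp : 1 ≤ p) (hq : 1 ≤ q) (hs : 1 ≤ s)
    (G : MetricJet S S' φ φ' W n p q s) (l : Fin 4) :
    Jet W n (oTrace p q s l) (fun y => ∑ k, S.Gam φ k k l y) (fun y => ∑ k, S'.Gam φ' k k l y) := by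
  have hW := B.isOpen
  unfold oTrace
  split_ifs with h
  · subst h
    exact Jet.of_zero hW (fun y hy => B.sum_Gam_two hy) (fun y hy => B'.sum_Gam_two hy)
  · exact Jet.sum hW fun k => jet_Gam B B' hp hq hs G k k l

theorem jet_quad (B : HorizonBox S φ κ₀ Λ W) (B' : HorizonBox S' φ' κ₀ Λ W)
    (hp : 1 ≤ p) (hq : 1 ≤ q) (hs : 1 ≤ s)
    (G : MetricJet S S' φ φ' W n p q s) (i j : Fin 4) :
    Jet W n (oQuad p q s i j)
      (fun y => ∑ k, ∑ l, (S.Gam φ k k l y * S.Gam φ l i j y - S.Gam φ k j l y * S.Gam φ l i k y))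
      (fun y => ∑ k, ∑ l, (S'.Gam φ' k k l y * S'.Gam φ' l i j y
        - S'.Gam φ' k j l y * S'.Gam φ' l i k y)) := by
  have hW := B.isOpen
  have Γ := jet_Gam B B' hp hq hs G
  have h1 := Jet.sum hW fun l => (jet_trace B B' hp hq hs G l).mul hW (Γ l i j)
  have h2 := Jet.sum hW fun k => Jet.sum hW fun l => (Γ k j l).mul hW (Γ l i k)
  refine (h1.sub hW h2).congr hW (fun y _ => ?_) (fun y _ => ?_)
  all_goals
    simp only [Finset.sum_sub_distrib, Finset.sum_mul]
    rw [Finset.sum_comm]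

theorem jet_pd_stat (hW : IsOpen W) {f f' : Coord → ℝ} {o : ℕ × ℕ} (h : Jet W n o f f')
    (hf : Stat W f) (hf' : Stat W f') (i : Fin 4) (ho : i = 3 → 1 ≤ o.2) :
    Jet W n (oPd i o) (pd i f) (pd i f') := by
  unfold oPd
  split_ifs with h1 h2
  · subst h1; exact Jet.of_zero hW hf.2 hf'.2
  · subst h2; exact h.pd_three hW (ho rfl)
  · exact h.pd_of_ne hW h2

/-- The stress tensor agrees to the order to which the metric and the field agree. -/
theorem jet_stress (hW : IsOpen W)
    (G : ∀ i j, Jet W n (0, 1) (comp2 S.g φ i j) (comp2 S'.g φ' i j))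
    (I : ∀ i j, Jet W n (0, 1) (S.ginv φ i j) (S'.ginv φ' i j))
    (F : ∀ i j, Jet W n (0, 1) (comp2 S.F φ i j) (comp2 S'.F φ' i j)) (i j : Fin 4) :
    Jet W n (0, 1) (S.stress φ i j) (S'.stress φ' i j) := by
  have h1 : Jet W n (0, 1) _ _ := Jet.sum hW fun k => Jet.sum hW fun l =>
    (((I k l).mul hW (F i k)).mul hW (F j l))
  have h2 : Jet W n (0, 1) _ _ := Jet.sum hW fun k => Jet.sum hW fun l => Jet.sum hW fun a =>
    Jet.sum hW fun b => ((((I k a).mul hW (I l b)).mul hW (F k l)).mul hW (F a b))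
  exact h1.sub hW (((G i j).const_mul hW (1 / 4)).mul hW h2)

/-- The Ricci tensor agrees to the order to which the metric and the field agree. -/
theorem jet_ricci (B : HorizonBox S φ κ₀ Λ W) (B' : HorizonBox S' φ' κ₀ Λ W)
    (G : MetricJet S S' φ φ' W n p q s) (F : FieldJet S S' φ φ' W n u x z c)
    (hp : 1 ≤ p) (hq : 1 ≤ q) (hs : 1 ≤ s) (hu : 1 ≤ u) (hx : 1 ≤ x) (hz : 1 ≤ z) (hc : 1 ≤ c)
    (i j : Fin 4) : Jet W n (0, 1) (S.ricci φ i j) (S'.ricci φ' i j) := by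
  have hW := B.isOpen
  have G1 : ∀ i j, Jet W n (0, 1) (comp2 S.g φ i j) (comp2 S'.g φ' i j) := fun i j =>
    (G i j).mono (by fin_cases i <;> fin_cases j <;> simp [oMetric, Prod.le_def] <;> assumption)
  have I1 : ∀ i j, Jet W n (0, 1) (S.ginv φ i j) (S'.ginv φ' i j) := fun i j =>
    (jet_ginv B B' G i j).mono (by
      fin_cases i <;> fin_cases j <;> simp [oInv, Prod.le_def] <;> omega)
  have F1 : ∀ i j, Jet W n (0, 1) (comp2 S.F φ i j) (comp2 S'.F φ' i j) := fun i j =>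
    (F i j).mono (by fin_cases i <;> fin_cases j <;> simp [oField, Prod.le_def] <;> assumption)
  have h : Jet W n (0, 1) _ _ := ((G1 i j).const_mul hW Λ).add hW
    ((jet_stress hW G1 I1 F1 i j).const_mul hW κ₀)
  -- The field equations enter here: Λ g + κ₀ T contains no derivatives, so the Ricci tensors agree
  -- to a higher order than their expressions in second derivatives of g would give.
  exact h.congr hW (fun y hy => (B.ricci_eq i j y hy).symm) (fun y hy => (B'.ricci_eq i j y hy).symm)

/-- With w the component of the volume form, w² = det g_AB gives (w + w')(w - w') = det g_AB - det
g'_AB. On the horizon w = w' ≠ 0, so the factor w + w' can be cancelled. -/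
theorem jet_vol (B : HorizonBox S φ κ₀ Λ W) (B' : HorizonBox S' φ' κ₀ Λ W)
    (h0 : ∀ y ∈ W, y 3 = 0 → comp4 S.vol φ 0 1 2 3 y = comp4 S'.vol φ' 0 1 2 3 y)
    (G : MetricJet S S' φ φ' W n p q s) (i j k l : Fin 4) :
    Jet W n (oVol p i j k l) (comp4 S.vol φ i j k l) (comp4 S'.vol φ' i j k l) := by
  have hW := B.isOpen
  have s1 := B.vol_smooth
  have s2 := B'.vol_smooth
  have g00 : Jet W n (0, p) _ _ := G 0 0
  have g01 : Jet W n (0, p) _ _ := G 0 1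
  have g11 : Jet W n (0, p) _ _ := G 1 1
  have D : Jet W n (0, p) (areaDet S φ) (areaDet S' φ') :=
    ((g00.mul hW g11).sub hW (g01.mul hW g01)).mono (by simp [omul])
  have hw : Jet W n (0, p) (comp4 S.vol φ 0 1 2 3) (comp4 S'.vol φ' 0 1 2 3) := by
    refine ⟨s1, s2, trivial, trivial, ?_⟩
    refine VanOn.of_mul_ne_zero hW (s1.add s2) (s1.sub s2) (fun y hy h3 h => ?_)
      (D.diff.congr hW fun y hy => ?_)
    · have hz : comp4 S.vol φ 0 1 2 3 y = 0 := by
        have := h0 y hy h3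
        linarith
      exact B.areaDet_ne y hy (by rw [← B.vol_sq y hy, hz, zero_mul])
    · simp only [← B.vol_sq y hy, ← B'.vol_sq y hy]; ring
  unfold oVol
  split_ifs with h
  · exact Jet.of_zero hW (fun y _ => by simp [B.vol_comp i j k l y, h])
      (fun y _ => by simp [B'.vol_comp i j k l y, h])
  · exact (hw.const_mul hW (leviCivita i j k l : ℝ)).congr hW
      (fun y _ => (B.vol_comp i j k l y).symm) (fun y _ => (B'.vol_comp i j k l y).symm)

theorem jet_star (B : HorizonBox S φ κ₀ Λ W) (B' : HorizonBox S' φ' κ₀ Λ W)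
    (h0 : ∀ y ∈ W, y 3 = 0 → comp4 S.vol φ 0 1 2 3 y = comp4 S'.vol φ' 0 1 2 3 y)
    (G : MetricJet S S' φ φ' W n p q s) (F : FieldJet S S' φ φ' W n u x z c) (i j : Fin 4) :
    Jet W n (oStar p q s u x z c i j) (S.starF φ i j) (S'.starF φ' i j) := by
  have hW := B.isOpen
  have V := jet_vol B B' h0 G
  have I := jet_ginv B B' G
  exact (Jet.sum hW fun k => Jet.sum hW fun l => Jet.sum hW fun a => Jet.sum hW fun b =>
    ((((V i j k l).mul hW (I k a)).mul hW (I l b)).mul hW (F a b))).const_mul hW (1 / 2)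

end Comparison

/-! ### Inductive step I: F_rA from the degenerate Maxwell equations -/

section Step

/-- q D - q' D' = q (D - D') + D' (q - q'). The last term vanishes to order n + 2, so its derivative
is negligible, and the simple zero of q gives the order of D - D'. -/
theorem Jet.of_pd_mul {W : Set Coord} {n : ℕ} {q q' D D' : Coord → ℝ} (hW : IsOpen W)
    (hq : Jet W n (1, 2) q q') (hq1 : ∀ y ∈ W, y 3 = 0 → pd 3 q y ≠ 0)
    (sD : ContDiffOn ℝ ∞ D W) (sD' : ContDiffOn ℝ ∞ D' W)
    (h : VanOn W (n + 1) fun y => pd 3 (fun z => q z * D z) y - pd 3 (fun z => q' z * D' z) y) :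
    Jet W n (0, 1) D D' := by
  refine ⟨sD, sD', trivial, trivial, ?_⟩
  have sq := hq.smooth
  have sq' := hq.smooth'
  have sdD := sD.sub sD'
  have sdq := sq.sub sq'
  refine VanOn.of_pd_mul hW sq sdD (fun y hy h3 => hq.van.eq_zero le_rfl hy h3) hq1 ?_
  have h2 : VanOn W (n + 2) (fun y => D' y * (q y - q' y)) := hq.diff.mul_left hW sD' sdq
  refine (h.sub hW h2.pd_three ((contDiffOn_pd hW (sq.mul sD) 3).sub
    (contDiffOn_pd hW (sq'.mul sD') 3)) (contDiffOn_pd hW (sD'.mul sdq) 3)).congr hW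
    fun y hy => ?_
  beta_reduce
  rw [← pd_sub hW (sq.mul sD) (sq'.mul sD') 3 hy,
    ← pd_sub hW ((sq.mul sD).sub (sq'.mul sD')) (sD'.mul sdq) 3 hy]
  exact pd_congr hW (fun z _ => by ring) 3 hy

/-- The common shape of the two degenerate equations: q = g^{rr}, the flux X is ⋆F_Av (up to sign)
or Γ^r_AB, and D contains the unknown F_rA or ∂_r g_AB. -/
theorem Jet.of_pd_mul_add {W : Set Coord} {n : ℕ} {q q' D D' R R' X X' : Coord → ℝ}
    (hW : IsOpen W) (hq : Jet W n (1, 2) q q') (hq1 : ∀ y ∈ W, y 3 = 0 → pd 3 q y ≠ 0)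
    (sD : ContDiffOn ℝ ∞ D W) (sD' : ContDiffOn ℝ ∞ D' W) (hR : Jet W n (0, 2) R R')
    (hX : Set.EqOn X (fun y => q y * D y + R y) W)
    (hX' : Set.EqOn X' (fun y => q' y * D' y + R' y) W)
    (h : Jet W n (0, 1) (pd 3 X) (pd 3 X')) : Jet W n (0, 1) D D' := by
  have s1 := hq.smooth.mul sD
  have s2 := hq.smooth'.mul sD'
  have h3 : Jet W n (0, 1) _ _ := hR.pd_three hW (by decide)
  refine Jet.of_pd_mul hW hq hq1 sD sD' ((h.sub hW h3).diff.congr hW fun y hy => ?_)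
  beta_reduce
  rw [pd_congr hW hX 3 hy, pd_congr hW hX' 3 hy, pd_add hW s1 hR.smooth 3 hy,
    pd_add hW s2 hR.smooth' 3 hy]
  ring

section Single

variable {M : Type*} [TopologicalSpace M] [ChartedSpace Coord M] {S : EMSpacetime M}
  {φ : Chart M} {κ₀ Λ : ℝ} {W : Set Coord}

/-- Contravariant components `F^{kl}`. -/
def fieldUp (S : EMSpacetime M) (φ : Chart M) (k l : Fin 4) (y : Coord) : ℝ :=
  ∑ a, ∑ b, S.ginv φ k a y * S.ginv φ l b y * comp2 S.F φ a b y

namespace HorizonBox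

theorem fieldUp_antisymm (B : HorizonBox S φ κ₀ Λ W) (k l : Fin 4) (y : Coord) :
    fieldUp S φ l k y = -fieldUp S φ k l y := by
  unfold fieldUp
  rw [Finset.sum_comm, ← Finset.sum_neg_distrib]
  refine Finset.sum_congr rfl fun a _ => ?_
  rw [← Finset.sum_neg_distrib]
  refine Finset.sum_congr rfl fun b _ => ?_
  rw [B.F_antisymm b a]; ring

theorem starF_eq (B : HorizonBox S φ κ₀ Λ W) (i j : Fin 4) (y : Coord) :
    S.starF φ i j y = (1 / 2) * ∑ k, ∑ l, (leviCivita i j k l : ℝ) *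
      (comp4 S.vol φ 0 1 2 3 y * fieldUp S φ k l y) := by
  unfold EMSpacetime.starF fieldUp
  simp only [Finset.mul_sum]
  refine Finset.sum_congr rfl fun k _ => Finset.sum_congr rfl fun l _ =>
    Finset.sum_congr rfl fun a _ => Finset.sum_congr rfl fun b _ => ?_
  rw [B.vol_comp i j k l]; ring

theorem starF_zero_one (B : HorizonBox S φ κ₀ Λ W) (y : Coord) :
    S.starF φ 0 1 y = comp4 S.vol φ 0 1 2 3 y * fieldUp S φ 2 3 y := by
  rw [B.starF_eq]
  simp [Fin.sum_univ_four, leviCivita, B.fieldUp_antisymm 2 3]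
  ring

theorem starF_one_two (B : HorizonBox S φ κ₀ Λ W) (y : Coord) :
    S.starF φ 1 2 y = comp4 S.vol φ 0 1 2 3 y * fieldUp S φ 0 3 y := by
  rw [B.starF_eq]
  simp [Fin.sum_univ_four, leviCivita, B.fieldUp_antisymm 0 3]
  ring

theorem starF_two_zero (B : HorizonBox S φ κ₀ Λ W) (y : Coord) :
    S.starF φ 2 0 y = comp4 S.vol φ 0 1 2 3 y * fieldUp S φ 1 3 y := by
  rw [B.starF_eq]
  simp [Fin.sum_univ_four, leviCivita, B.fieldUp_antisymm 1 3]
  ring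

theorem F_self (B : HorizonBox S φ κ₀ Λ W) (i : Fin 4) (y : Coord) : comp2 S.F φ i i y = 0 := by
  have := B.F_antisymm i i y
  linarith

theorem ginv_two (B : HorizonBox S φ κ₀ Λ W) {y : Coord} (hy : y ∈ W) (j : Fin 4) :
    S.ginv φ 2 j y = if j = 3 then 1 else 0 := by
  rw [B.ginv_eq hy]; fin_cases j <;> rfl

theorem fieldUp_two_three (B : HorizonBox S φ κ₀ Λ W) {y : Coord} (hy : y ∈ W) :
    fieldUp S φ 2 3 y = comp2 S.F φ 3 2 y +
      (S.ginv φ 3 0 y * comp2 S.F φ 3 0 y + S.ginv φ 3 1 y * comp2 S.F φ 3 1 y) := by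
  unfold fieldUp
  have e : S.ginv φ 3 2 y = 1 := by rw [B.ginv_symm 3 2 hy, B.ginv_two hy]; rfl
  simp only [Fin.sum_univ_four, B.ginv_two hy, B.F_self, e]
  simp
  ring

/-- Isolates F_rA with its coefficient g^{rr}. The final sum still contains F_rB, but for a surface
index i only with g^{ir} g^{rB}, a double zero at the horizon, so the order already known suffices
there. -/
theorem fieldUp_three (B : HorizonBox S φ κ₀ Λ W) {y : Coord} (hy : y ∈ W) {i : Fin 4}
    (hi : i ≠ 3) : fieldUp S φ i 3 y = S.ginv φ 3 3 y *
      (S.ginv φ i 0 y * comp2 S.F φ 0 3 y + S.ginv φ i 1 y * comp2 S.F φ 1 3 y) +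
      ∑ a, ((S.ginv φ i a y * S.ginv φ 3 0 y * comp2 S.F φ a 0 y +
        S.ginv φ i a y * S.ginv φ 3 1 y * comp2 S.F φ a 1 y) +
        S.ginv φ i a y * S.ginv φ 3 2 y * comp2 S.F φ a 2 y) := by
  have e : S.ginv φ i 2 y = 0 := by rw [B.ginv_symm i 2 hy, B.ginv_two hy, if_neg hi]
  unfold fieldUp
  simp only [Fin.sum_univ_four, B.F_self, e]
  ring

theorem lower_field (B : HorizonBox S φ κ₀ Λ W) {i : Fin 4} (hi : i < 2) {y : Coord}
    (hy : y ∈ W) {a b : ℝ} :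
    comp2 S.g φ i 0 y * (S.ginv φ 0 0 y * a + S.ginv φ 0 1 y * b) +
      comp2 S.g φ i 1 y * (S.ginv φ 1 0 y * a + S.ginv φ 1 1 y * b) = if i = 0 then a else b := by
  have hd := B.areaDet_ne y hy
  have e : comp2 S.g φ 1 0 y = comp2 S.g φ 0 1 y := by rw [B.g_symm]
  rw [B.ginv_eq hy 0 0, B.ginv_eq hy 0 1, B.ginv_eq hy 1 0, B.ginv_eq hy 1 1]
  obtain rfl | rfl : i = 0 ∨ i = 1 := by revert i; decide
  all_goals
    simp [e]
    field_simp
    simp only [areaDet]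
    ring

theorem vol_ne (B : HorizonBox S φ κ₀ Λ W) {y : Coord} (hy : y ∈ W) :
    comp4 S.vol φ 0 1 2 3 y ≠ 0 := fun h =>
  B.areaDet_ne y hy (by rw [← B.vol_sq y hy, h, zero_mul])

/-- The square of the volume component is det g_AB, which does not depend on v, and the component
itself never vanishes. -/
theorem stat_vol (B : HorizonBox S φ κ₀ Λ W) (i j k l : Fin 4) :
    Stat W (comp4 S.vol φ i j k l) := by
  have hW := B.isOpen
  have sw := B.vol_smooth
  have hw : Stat W (comp4 S.vol φ 0 1 2 3) := by
    refine ⟨sw, fun y hy => ?_⟩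
    have h1 : Stat W (areaDet S φ) := ((B.stat_g 0 0).mul hW (B.stat_g 1 1)).sub hW
      ((B.stat_g 0 1).mul hW (B.stat_g 0 1))
    have h2 := (h1.congr hW fun z hz => (B.vol_sq z hz).symm).2 y hy
    rw [pd_mul hW sw sw 2 hy] at h2
    have h3 : comp4 S.vol φ 0 1 2 3 y * pd 2 (comp4 S.vol φ 0 1 2 3) y = 0 := by linarith
    exact (mul_eq_zero.1 h3).resolve_left (B.vol_ne hy)
  exact ((Stat.const (leviCivita i j k l : ℝ)).mul hW hw).congr hW
    fun y _ => (B.vol_comp i j k l y).symm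

theorem stat_starF (B : HorizonBox S φ κ₀ Λ W) (i j : Fin 4) : Stat W (S.starF φ i j) := by
  have hW := B.isOpen
  exact (Stat.const (1 / 2)).mul hW (Stat.sum hW fun k => Stat.sum hW fun l => Stat.sum hW fun a =>
    Stat.sum hW fun b => (((B.stat_vol i j k l).mul hW (B.stat_ginv k a)).mul hW
      (B.stat_ginv l b)).mul hW ⟨B.F_smooth a b, B.F_stat a b⟩)

theorem vanOn_g_two (B : HorizonBox S φ κ₀ Λ W) {j : Fin 4} (hj : j ≠ 3) :
    VanOn W 1 (comp2 S.g φ 2 j) := ⟨fun y hy h3 => B.g_null y hy h3 j hj, trivial⟩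

/-- Comparing a spacetime with itself turns the order tables into statements about which quantities
vanish on the horizon. -/
theorem metricJet_self (B : HorizonBox S φ κ₀ Λ W) (n : ℕ) : MetricJet S S φ φ W n 9 9 9 := by
  refine metricJet_of_ne B B fun i j hi hj => ?_
  have sg := B.g_smooth i j
  have hd : VanOn W (n + 9) fun y => comp2 S.g φ i j y - comp2 S.g φ i j y :=
    VanOn.zero B.isOpen _ (by simp)
  by_cases h2 : i = 2
  · subst h2
    have hv := B.vanOn_g_two hj
    exact (⟨sg, sg, hv, hv, hd⟩ : Jet W n (1, 9) _ _).mono (by fin_cases j <;> decide)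
  by_cases h2' : j = 2
  · subst h2'
    have hv := B.vanOn_g_two hi
    rw [B.g_symm 2 i] at hv
    exact (⟨sg, sg, hv, hv, hd⟩ : Jet W n (1, 9) _ _).mono (by fin_cases i <;> decide)
  · refine (⟨sg, sg, trivial, trivial, hd⟩ : Jet W n (0, 9) _ _).mono ?_
    clear sg hd
    revert i j
    decide

/-- `∂_r g^{rr} = -∂_r g_vv` at the horizon. -/
theorem pd_ginv_three (B : HorizonBox S φ κ₀ Λ W) {y : Coord} (hy : y ∈ W) (h3 : y 3 = 0) :
    pd 3 (S.ginv φ 3 3) y = -pd 3 (comp2 S.g φ 2 2) y := by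
  have hW := B.isOpen
  have I := jet_ginv B B (B.metricJet_self 0)
  -- The corrections g^{rA} g_Av to g^{rr} = -g_vv - ... have double zeros and do not contribute to
  -- the first derivative.
  have h : ∀ j, j ≠ 2 → j ≠ 3 → VanOn W 2 fun y => S.ginv φ 3 j y * comp2 S.g φ j 2 y := by
    intro j hj hj'
    rw [B.g_symm j 2]
    refine VanOn.mul hW (a := 1) (b := 1) ((I 3 j).van.mono ?_) (B.vanOn_g_two hj')
      (I 3 j).smooth (B.g_smooth 2 j)
    revert j; decide
  have s0 := (I 3 0).smooth.mul (B.g_smooth 0 2)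
  have s1 := (I 3 1).smooth.mul (B.g_smooth 1 2)
  have hsum := (h 0 (by decide) (by decide)).add hW (h 1 (by decide) (by decide)) s0 s1
  have e0 := hsum.2.1 y hy h3
  have e : Set.EqOn (S.ginv φ 3 3) (fun y => -1 * (comp2 S.g φ 2 2 y + (S.ginv φ 3 0 y *
      comp2 S.g φ 0 2 y + S.ginv φ 3 1 y * comp2 S.g φ 1 2 y))) W := fun z hz => by
    beta_reduce
    rw [B.ginv_eq hz 3 0, B.ginv_eq hz 3 1, B.ginv_eq hz 3 3]
    rfl
  rw [pd_congr hW e 3 hy, pd_mul hW contDiffOn_const ((B.g_smooth 2 2).add (s0.add s1)) 3 hy,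
    pd_add hW (B.g_smooth 2 2) (s0.add s1) 3 hy, e0]
  simp [pd]

theorem pd_ginv_three_ne (B : HorizonBox S φ κ₀ Λ W) :
    ∀ y ∈ W, y 3 = 0 → pd 3 (S.ginv φ 3 3) y ≠ 0 := fun y hy h3 => by
  rw [B.pd_ginv_three hy h3]
  exact neg_ne_zero.2 (B.surfaceGravity_ne y hy h3)

end HorizonBox

end Single

variable {M M' : Type*} [TopologicalSpace M] [ChartedSpace Coord M] [TopologicalSpace M']
  [ChartedSpace Coord M'] {S : EMSpacetime M} {S' : EMSpacetime M'} {φ : Chart M} {φ' : Chart M'}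
  {κ₀ Λ : ℝ} {W : Set Coord} {n p q s u x z c : ℕ}

/-- Maxwell's equations on the surfaces of constant `r` determine `F_rA` at the horizon from the
field components with fewer radial indices: the coefficient `g^{rr}` has a simple zero. -/
theorem fieldJet_radial (B : HorizonBox S φ κ₀ Λ W) (B' : HorizonBox S' φ' κ₀ Λ W)
    (h0 : ∀ y ∈ W, y 3 = 0 → comp4 S.vol φ 0 1 2 3 y = comp4 S'.vol φ' 0 1 2 3 y)
    (G : MetricJet S S' φ φ' W n 1 2 2) (F : FieldJet S S' φ φ' W n 1 1 2 0) :
    FieldJet S S' φ φ' W n 1 1 2 1 := by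
  have hW := B.isOpen
  have I := jet_ginv B B' G
  have sF := fun i j => (F i j).smooth
  have sF' := fun i j => (F i j).smooth'
  have sI := fun i j => (I i j).smooth
  have sI' := fun i j => (I i j).smooth'
  have T := jet_star B B' h0 G F
  have hw : Jet W n (0, 1) (comp4 S.vol φ 0 1 2 3) (comp4 S'.vol φ' 0 1 2 3) :=
    jet_vol B B' h0 G 0 1 2 3
  -- the part of the flux without `F_rA`
  have R : ∀ i, i < 2 → Jet W n (1, 2)
      (fun y => ∑ a, ((S.ginv φ i a y * S.ginv φ 3 0 y * comp2 S.F φ a 0 y +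
        S.ginv φ i a y * S.ginv φ 3 1 y * comp2 S.F φ a 1 y) +
        S.ginv φ i a y * S.ginv φ 3 2 y * comp2 S.F φ a 2 y))
      (fun y => ∑ a, ((S'.ginv φ' i a y * S'.ginv φ' 3 0 y * comp2 S'.F φ' a 0 y +
        S'.ginv φ' i a y * S'.ginv φ' 3 1 y * comp2 S'.F φ' a 1 y) +
        S'.ginv φ' i a y * S'.ginv φ' 3 2 y * comp2 S'.F φ' a 2 y)) := by
    intro i hi
    refine (Jet.sum hW fun a => (((((I i a).mul hW (I 3 0)).mul hW (F a 0)).add hW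
      (((I i a).mul hW (I 3 1)).mul hW (F a 1))).add hW
      (((I i a).mul hW (I 3 2)).mul hW (F a 2)))).mono ?_
    revert i; decide +kernel
  have key : ∀ i (X X' : Coord → ℝ), i < 2 →
      (∀ y, X y = comp4 S.vol φ 0 1 2 3 y * fieldUp S φ i 3 y) →
      (∀ y, X' y = comp4 S'.vol φ' 0 1 2 3 y * fieldUp S' φ' i 3 y) →
      Jet W n (0, 1) (pd 3 X) (pd 3 X') →
      Jet W n (0, 1)
        (fun y => S.ginv φ i 0 y * comp2 S.F φ 0 3 y + S.ginv φ i 1 y * comp2 S.F φ 1 3 y)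
        (fun y => S'.ginv φ' i 0 y * comp2 S'.F φ' 0 3 y
          + S'.ginv φ' i 1 y * comp2 S'.F φ' 1 3 y) := by
    intro i X X' hi hX hX' h
    have sE := ((sI i 0).mul (sF 0 3)).add ((sI i 1).mul (sF 1 3))
    have sE' := ((sI' i 0).mul (sF' 0 3)).add ((sI' i 1).mul (sF' 1 3))
    have hi3 : i ≠ 3 := by rintro rfl; exact absurd hi (by decide)
    have wR := (hw.mul hW (R i hi)).mono (t := (0, 2)) (by decide)
    have D := Jet.of_pd_mul_add hW (I 3 3) B.pd_ginv_three_ne (hw.smooth.mul sE)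
      (hw.smooth'.mul sE') wR (fun y hy => by rw [hX, B.fieldUp_three hy hi3]; ring)
      (fun y hy => by rw [hX', B'.fieldUp_three hy hi3]; ring) h
    have hwi := hw.inv hW (fun y hy => B.vol_ne hy) (fun y hy => B'.vol_ne hy)
    have DD : Jet W n (0, 1) _ _ := hwi.mul hW D
    refine DD.congr hW (fun y hy => ?_) (fun y hy => ?_)
    · exact inv_mul_cancel_left₀ (B.vol_ne hy) _
    · exact inv_mul_cancel_left₀ (B'.vol_ne hy) _
  have st : ∀ i j, Jet W n (9, 9) (pd 2 (S.starF φ i j)) (pd 2 (S'.starF φ' i j)) := fun i j =>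
    Jet.of_zero hW (B.stat_starF i j).2 (B'.stat_starF i j).2
  -- In ⋆F_vr the component F_rA appears only with a factor g^{rB} that vanishes on the horizon, so
  -- this side of the equation agrees to order n + 1 although F_rA is known only to order n.
  have T23 := ((T 2 3).pd_of_ne hW (i := 1) (by decide)).mono (t := (0, 1)) (by decide +kernel)
  have T03 := ((T 3 2).pd_of_ne hW (i := 0) (by decide)).mono (t := (0, 1)) (by decide +kernel)
  have E0 := key 0 (S.starF φ 1 2) (S'.starF φ' 1 2) (by decide) B.starF_one_two
    B'.starF_one_two ((((T23.add hW (st 3 1)).const_mul hW (-1)).congr hW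
      (fun y hy => by linarith [B.maxwell_star 1 2 3 y hy])
      (fun y hy => by linarith [B'.maxwell_star 1 2 3 y hy])).mono (by decide))
  have E1 := key 1 (S.starF φ 2 0) (S'.starF φ' 2 0) (by decide) B.starF_two_zero
    B'.starF_two_zero ((((T03.add hW (st 0 3)).const_mul hW (-1)).congr hW
      (fun y hy => by linarith [B.maxwell_star 2 0 3 y hy])
      (fun y hy => by linarith [B'.maxwell_star 2 0 3 y hy])).mono (by decide))
  -- The flux yields g^{AB} F_Br; g_AB lowers the index because the surface block of the inverse
  -- metric is the inverse of the surface block.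
  have F3 : ∀ i, i < 2 → Jet W n (0, 1) (comp2 S.F φ i 3) (comp2 S'.F φ' i 3) := by
    intro i hi
    have hi01 : i = 0 ∨ i = 1 := by revert i; decide
    have Gi : ∀ j, j < 2 → Jet W n (0, 1) (comp2 S.g φ i j) (comp2 S'.g φ' i j) := fun j hj =>
      (G i j).mono (by revert i j; decide)
    refine (((Gi 0 (by decide)).mul hW E0).add hW ((Gi 1 (by decide)).mul hW E1)).congr hW
      (fun y hy => ?_) (fun y hy => ?_)
    · rcases hi01 with rfl | rfl
      · exact B.lower_field hi hy
      · exact B.lower_field hi hy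
    · rcases hi01 with rfl | rfl
      · exact B'.lower_field hi hy
      · exact B'.lower_field hi hy
  refine fieldJet_of_ne B B' fun i j hij => ?_
  by_cases hj : j = 3
  · subst hj
    by_cases hi : i = 2
    · subst hi; exact F 2 3
    · exact (F3 i (by revert i; decide)).mono (by revert i; decide)
  · exact (F i j).mono (by revert i j; decide)

end Step

/-! ### Inductive step II: Einstein's equations and the remaining Maxwell equations -/

section Step

variable {M M' : Type*} [TopologicalSpace M] [ChartedSpace Coord M] [TopologicalSpace M']
  [ChartedSpace Coord M'] {S : EMSpacetime M} {S' : EMSpacetime M'} {φ : Chart M} {φ' : Chart M'}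
  {κ₀ Λ : ℝ} {W : Set Coord} {n p q s u x z c : ℕ}

/-- R_ij is solved for ∂_r Γ^r_ij. Since j ≠ r, this is the only radial derivative of a Christoffel
symbol in R_ij; the three order conditions say that all other terms already agree to order n + 1. -/
theorem jet_pd_Gam_three (B : HorizonBox S φ κ₀ Λ W) (B' : HorizonBox S' φ' κ₀ Λ W)
    (G : MetricJet S S' φ φ' W n p q s) (F : FieldJet S S' φ φ' W n u x z c)
    (hp : 1 ≤ p) (hq : 1 ≤ q) (hs : 1 ≤ s) (hu : 1 ≤ u) (hx : 1 ≤ x) (hz : 1 ≤ z) (hc : 1 ≤ c)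
    {i j : Fin 4} (hj : j ≠ 3) (hquad : (0, 1) ≤ oQuad p q s i j)
    (h1 : ∀ k, k ≠ 3 → (0, 1) ≤ oPd k (oGam p q s k i j))
    (h2 : ∀ k, (0, 1) ≤ oPd j (oGam p q s k i k)) :
    Jet W n (0, 1) (pd 3 (S.Gam φ 3 i j)) (pd 3 (S'.Gam φ' 3 i j)) := by
  have hW := B.isOpen
  have Γ := jet_Gam B B' hp hq hs G
  have Rc := jet_ricci B B' G F hp hq hs hu hx hz hc i j
  have Q := (jet_quad B B' hp hq hs G i j).mono hquad
  have d1 : ∀ k, k ≠ 3 → Jet W n (0, 1) (pd k (S.Gam φ k i j)) (pd k (S'.Gam φ' k i j)) :=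
    fun k hk => (jet_pd_stat hW (Γ k i j) (B.stat_Gam k i j) (B'.stat_Gam k i j) k
      (fun h => absurd h hk)).mono (h1 k hk)
  have d2 : ∀ k, Jet W n (0, 1) (pd j (S.Gam φ k i k)) (pd j (S'.Gam φ' k i k)) :=
    fun k => (jet_pd_stat hW (Γ k i k) (B.stat_Gam k i k) (B'.stat_Gam k i k) j
      (fun h => absurd h hj)).mono (h2 k)
  have s2 : Jet W n (0, 1) _ _ := Jet.sum hW d2
  have s1 := ((d1 0 (by decide)).add hW (d1 1 (by decide))).add hW (d1 2 (by decide))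
  refine (((Rc.sub hW s1).add hW s2).sub hW Q).congr hW (fun y _ => ?_) (fun y _ => ?_)
  all_goals
    simp only [EMSpacetime.ricci]
    rw [Fin.sum_univ_four (fun k => pd k _ _)]
    ring

/-- The equations `R_AB` determine `∂_r g_AB` at the horizon from lower orders: the coefficient
`g^{rr}` has a simple zero. -/
theorem metricJet_surface (B : HorizonBox S φ κ₀ Λ W) (B' : HorizonBox S' φ' κ₀ Λ W)
    (G : MetricJet S S' φ φ' W n 1 2 2) (F : FieldJet S S' φ φ' W n 1 1 2 1) :
    MetricJet S S' φ φ' W n 2 2 2 := by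
  have hW := B.isOpen
  have I := jet_ginv B B' G
  have C := jet_christ B B' (by decide) (by decide) (by decide) G
  refine metricJet_of_ne B B' fun i j hi hj => ?_
  by_cases h2 : i = 2 ∨ j = 2
  · exact (G i j).mono (by revert i j; decide)
  have hd : Jet W n (0, 1) (pd 3 (S.Gam φ 3 i j)) (pd 3 (S'.Gam φ' 3 i j)) := by
    refine jet_pd_Gam_three B B' G F (by decide) (by decide) (by decide) (by decide) (by decide)
      (by decide) (by decide) hj ?_ ?_ ?_
    all_goals revert i j; decide +kernel
  have s3 := fun i j => contDiffOn_pd hW (B.g_smooth i j) 3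
  have s3' := fun i j => contDiffOn_pd hW (B'.g_smooth i j) 3
  have sc : ContDiffOn ℝ ∞ (fun _ : Coord => (-(1 / 2) : ℝ)) W := contDiffOn_const
  have R := ((((I 3 0).mul hW (C i j 0)).add hW ((I 3 1).mul hW (C i j 1))).add hW
    ((I 3 2).mul hW (C i j 2))).const_mul hW (1 / 2) |>.mono (t := (0, 2)) (by
      clear hd; revert i j; decide +kernel)
  -- As g_Ar is constant, Γ^r_AB = g^{rr} (-½ ∂_r g_AB) + R, with R free of g^{rr}; this is where
  -- the constant -½ comes from.
  have D := Jet.of_pd_mul_add hW (I 3 3) B.pd_ginv_three_ne (sc.mul (s3 i j))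
    (sc.mul (s3' i j)) R (fun y hy => ?_) (fun y hy => ?_) hd
  rotate_left
  · simp only [EMSpacetime.Gam, Fin.sum_univ_four,
      pd_eq_zero_of_const hW (B.g_radial' _) _ y hy]
    ring
  · simp only [EMSpacetime.Gam, Fin.sum_univ_four,
      pd_eq_zero_of_const hW (B'.g_radial' _) _ y hy]
    ring
  have D2 := (D.const_mul hW (-2)).diff.congr hW (g := fun y => pd 3 (comp2 S.g φ i j) y -
    pd 3 (comp2 S'.g φ' i j) y) fun y _ => by ring
  have G1 : Jet W n (0, 1) _ _ := (G i j).mono (by clear * - hi hj h2; revert i j; decide)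
  refine (G1.of_pd_three (s := (0, 1)) hW (k := 1) D2).mono ?_
  clear * - hi hj h2; revert i j; decide

/-- The equations `R_rA` and `R_rv` determine the second radial derivatives of `g_vA` and `g_vv`. -/
theorem metricJet_null (B : HorizonBox S φ κ₀ Λ W) (B' : HorizonBox S' φ' κ₀ Λ W)
    (G : MetricJet S S' φ φ' W n 2 2 2) (F : FieldJet S S' φ φ' W n 1 1 2 1) :
    MetricJet S S' φ φ' W n 2 3 3 := by
  have hW := B.isOpen
  have I := jet_ginv B B' G
  have C := jet_christ B B' (by decide) (by decide) (by decide) G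
  have main : ∀ j, j ≠ 3 → Jet W n (1, 3) (comp2 S.g φ 2 j) (comp2 S'.g φ' 2 j) := by
    intro j hj
    have hd : Jet W n (0, 1) (pd 3 (S.Gam φ 3 3 j)) (pd 3 (S'.Gam φ' 3 3 j)) := by
      refine jet_pd_Gam_three B B' G F (by decide) (by decide) (by decide) (by decide) (by decide)
        (by decide) (by decide) hj ?_ ?_ ?_
      all_goals revert j; decide +kernel
    -- In the gauge g_rj = δ_jv one has 2 Γ^r_rj = ∂_r g_vj + R. For j = B the term g^{rA} ∂_r g_AB
    -- in R needs ∂_r g_AB to order n + 1, which is the gain made by `metricJet_surface`.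
    have R := (((I 3 0).mul hW (C 3 j 0)).add hW ((I 3 1).mul hW (C 3 j 1))).mono
      (t := (0, 2)) (by clear hd; revert j; decide +kernel)
    have Γ := (jet_Gam B B' (by decide) (by decide) (by decide) G 3 3 j).mono (t := (0, 1)) (by
      clear hd R; revert j; decide +kernel)
    have Γ2 : Jet W n (0, 2) _ _ := Jet.of_pd_three (s := (0, 1)) hW (k := 1) Γ hd.diff
    have D := (((Γ2.const_mul hW 2).sub hW R).congr hW (g := pd 3 (comp2 S.g φ 2 j))
      (g' := pd 3 (comp2 S'.g φ' 2 j)) (fun y hy => ?_) (fun y hy => ?_))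
    rotate_left
    · have e : S.ginv φ 3 2 y = 1 := by rw [B.ginv_eq hy]; rfl
      simp only [EMSpacetime.Gam, Fin.sum_univ_four, B.g_symm j 2, e,
        pd_eq_zero_of_const hW (B.g_radial' _) _ y hy,
        pd_eq_zero_of_const hW (B.g_radial _) _ y hy]
      ring
    · have e : S'.ginv φ' 3 2 y = 1 := by rw [B'.ginv_eq hy]; rfl
      simp only [EMSpacetime.Gam, Fin.sum_univ_four, B'.g_symm j 2, e,
        pd_eq_zero_of_const hW (B'.g_radial' _) _ y hy,
        pd_eq_zero_of_const hW (B'.g_radial _) _ y hy]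
      ring
    have G1 : Jet W n (1, 1) _ _ := (G 2 j).mono (by clear * - hj; revert j; decide)
    exact G1.of_pd_three (s := (1, 1)) hW (k := 2) D.diff
  refine metricJet_of_ne B B' fun i j hi hj => ?_
  by_cases h2 : i = 2
  · subst h2
    exact (main j hj).mono (by revert j; decide)
  by_cases h2' : j = 2
  · subst h2'
    rw [B.g_symm i 2, B'.g_symm i 2]
    exact (main i hi).mono (by revert i; decide)
  · exact (G i j).mono (by revert i j; decide)

/-- Maxwell's equations determine the radial derivatives of `F_AB`, `F_vr` and `F_vA`. -/
theorem fieldJet_transport (B : HorizonBox S φ κ₀ Λ W) (B' : HorizonBox S' φ' κ₀ Λ W)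
    (h0 : ∀ y ∈ W, y 3 = 0 → comp4 S.vol φ 0 1 2 3 y = comp4 S'.vol φ' 0 1 2 3 y)
    (G : MetricJet S S' φ φ' W n 2 2 2) (F : FieldJet S S' φ φ' W n 1 1 2 1) :
    FieldJet S S' φ φ' W n 2 2 3 1 := by
  have hW := B.isOpen
  have I := jet_ginv B B' G
  have T := jet_star B B' h0 G F
  have hw : Jet W n (0, 2) (comp4 S.vol φ 0 1 2 3) (comp4 S'.vol φ' 0 1 2 3) :=
    jet_vol B B' h0 G 0 1 2 3
  have F1 : ∀ i j, Jet W n (0, 1) (comp2 S.F φ i j) (comp2 S'.F φ' i j) := fun i j =>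
    (F i j).mono (by revert i j; decide)
  have T1 : ∀ i j, i ≠ 2 → j ≠ 2 → Jet W n (0, 1) (S.starF φ i j) (S'.starF φ' i j) :=
    fun i j hi hj => (T i j).mono (by revert i j; decide +kernel)
  have F01 : Jet W n (0, 2) (comp2 S.F φ 0 1) (comp2 S'.F φ' 0 1) := by
    have d := (((F1 1 3).pd_of_ne hW (i := 0) (by decide)).add hW
      ((F1 3 0).pd_of_ne hW (i := 1) (by decide))).const_mul hW (-1) |>.congr hW
      (g := pd 3 (comp2 S.F φ 0 1)) (g' := pd 3 (comp2 S'.F φ' 0 1))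
      (fun y hy => by linarith [B.maxwell 0 1 3 y hy])
      (fun y hy => by linarith [B'.maxwell 0 1 3 y hy])
    exact (F1 0 1).of_pd_three (s := (0, 1)) hW (k := 1) d.diff
  have T01 : Jet W n (0, 2) (S.starF φ 0 1) (S'.starF φ' 0 1) := by
    have d := (((T1 1 3 (by decide) (by decide)).pd_of_ne hW (i := 0) (by decide)).add hW
      ((T1 3 0 (by decide) (by decide)).pd_of_ne hW (i := 1) (by decide))).const_mul hW (-1)
      |>.congr hW (g := pd 3 (S.starF φ 0 1)) (g' := pd 3 (S'.starF φ' 0 1))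
      (fun y hy => by linarith [B.maxwell_star 0 1 3 y hy])
      (fun y hy => by linarith [B'.maxwell_star 0 1 3 y hy])
    exact (T1 0 1 (by decide) (by decide)).of_pd_three (s := (0, 1)) hW (k := 1) d.diff
  have F32 : Jet W n (0, 2) (comp2 S.F φ 3 2) (comp2 S'.F φ' 3 2) := by
    -- ⋆F_01 is the volume component times F^{vr}, and F^{vr} = F_rv + g^{rA} F_rA. The zero of
    -- g^{rA} lifts the order n + 1 of F_rA to n + 2.
    have R := ((I 3 0).mul hW (F 3 0)).add hW ((I 3 1).mul hW (F 3 1))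
    have hwi := hw.inv hW (fun y hy => B.vol_ne hy) (fun y hy => B'.vol_ne hy)
    refine (((hwi.mul hW T01).sub hW R).congr hW (fun y hy => ?_) (fun y hy => ?_)).mono
      (by decide +kernel)
    · simp only [B.starF_zero_one, inv_mul_cancel_left₀ (B.vol_ne hy), B.fieldUp_two_three hy]
      ring
    · simp only [B'.starF_zero_one, inv_mul_cancel_left₀ (B'.vol_ne hy), B'.fieldUp_two_three hy]
      ring
  have F23 : Jet W n (0, 2) (comp2 S.F φ 2 3) (comp2 S'.F φ' 2 3) :=
    (F32.const_mul hW (-1)).congr hW (fun y _ => by simp only [B.F_antisymm 2 3]; ring)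
      (fun y _ => by simp only [B'.F_antisymm 2 3]; ring)
  have FA2 : ∀ i, i < 2 → Jet W n (1, 3) (comp2 S.F φ i 2) (comp2 S'.F φ' i 2) := by
    intro i hi
    have hi3 : i ≠ 3 := by rintro rfl; exact absurd hi (by decide)
    -- Stationarity reduces the component (A v r) of dF = 0 to ∂_r F_Av = -∂_A F_vr, so F_Av gains
    -- one order over F_vr.
    have d := ((F23.pd_of_ne hW hi3).const_mul hW (-1)).congr hW
      (g := pd 3 (comp2 S.F φ i 2)) (g' := pd 3 (comp2 S'.F φ' i 2))
      (fun y hy => by linarith [B.maxwell i 2 3 y hy, B.F_stat 3 i y hy])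
      (fun y hy => by linarith [B'.maxwell i 2 3 y hy, B'.F_stat 3 i y hy])
    have F0 : Jet W n (1, 1) _ _ := (F i 2).mono (by clear d; revert i; decide)
    exact F0.of_pd_three (s := (1, 1)) hW (k := 2) d.diff
  refine fieldJet_of_ne B B' fun i j hij => ?_
  by_cases hj : j = 3
  · subst hj
    by_cases hi : i = 2
    · subst hi; exact F23
    · exact (F i 3).mono (by revert i; decide)
  by_cases hj2 : j = 2
  · subst hj2
    exact (FA2 i hij).mono (by clear * - hij; revert i; decide)
  · obtain ⟨rfl, rfl⟩ : i = 0 ∧ j = 1 := by clear * - hij hj hj2; revert i j; decide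
    exact F01

/-- Pure re-indexing: n + s.2 = (n + 1) + (s.2 - 1). -/
theorem Jet.succ {n : ℕ} {s : ℕ × ℕ} {f f' : Coord → ℝ} (h : Jet W n s f f') (hs : 1 ≤ s.2) :
    Jet W (n + 1) (s.1, s.2 - 1) f f' :=
  ⟨h.smooth, h.smooth', h.van, h.van', h.diff.mono (by simp only; omega)⟩

/-- Two electrovac Killing horizons with the same horizon data agree to all orders. -/
theorem horizonBox_jets (B : HorizonBox S φ κ₀ Λ W) (B' : HorizonBox S' φ' κ₀ Λ W)
    (h0 : ∀ y ∈ W, y 3 = 0 → comp4 S.vol φ 0 1 2 3 y = comp4 S'.vol φ' 0 1 2 3 y)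
    (G : MetricJet S S' φ φ' W 0 1 2 2) (F : FieldJet S S' φ φ' W 0 1 1 2 0) (n : ℕ) :
    MetricJet S S' φ φ' W n 1 2 2 ∧ FieldJet S S' φ φ' W n 1 1 2 0 := by
  induction n with
  | zero => exact ⟨G, F⟩
  | succ n ih =>
    -- The order matters: R_AB contains the stress tensor and so needs F_rA first, while R_rA needs
    -- the improved g_AB. The orders (1,2,2) and (1,1,2,0) become (2,3,3) and (2,2,3,1), a gain of
    -- exactly one in each slot.
    have F1 := fieldJet_radial B B' h0 ih.1 ih.2
    have G1 := metricJet_surface B B' ih.1 F1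
    have F2 := fieldJet_transport B B' h0 G1 F1
    have G2 := metricJet_null B B' G1 F1
    refine ⟨metricJet_of_ne B B' fun i j hi hj => ?_, fieldJet_of_ne B B' fun i j hij => ?_⟩
    · refine ((G2 i j).succ ?_).mono ?_
      all_goals revert i j; decide
    · refine ((F2 i j).succ ?_).mono ?_
      all_goals revert i j; decide

end Step

/-! ### Pointwise algebra: volume form, trace of Einstein's equations, null frames -/

section Reduction

variable {M : Type*} [TopologicalSpace M] [ChartedSpace Coord M] {S : EMSpacetime M}
  {φ : Chart M}

/-- The Vandermonde product of 0, 1, 2, 3 is 12, and permuting its arguments multiplies it by the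
sign. -/
theorem leviCivita_perm (σ : Equiv.Perm (Fin 4)) :
    leviCivita (σ 0) (σ 1) (σ 2) (σ 3) = (Equiv.Perm.sign σ : ℤ) := by
  revert σ; decide +kernel

theorem leviCivita_of_not_injective (i j k l : Fin 4)
    (h : ¬ Function.Injective ![i, j, k, l]) : leviCivita i j k l = 0 := by
  revert i j k l; decide +kernel

theorem comp4_eq (T : FourForm M) (φ : Chart M) (i j k l : Fin 4) (y : Coord) :
    comp4 T φ i j k l y = (leviCivita i j k l : ℝ) * comp4 T φ 0 1 2 3 y := by
  have e : ∀ i j k l : Fin 4, comp4 T φ i j k l y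
      = T (φ.symm y) ((fun a => coordVec φ a y) ∘ ![i, j, k, l]) := by
    intro i j k l
    unfold comp4
    congr 1
    ext a
    fin_cases a <;> rfl
  by_cases h : Function.Injective ![i, j, k, l]
  · let σ : Equiv.Perm (Fin 4) := Equiv.ofBijective _ (Finite.injective_iff_bijective.1 h)
    have h1 := (T (φ.symm y)).map_perm (fun a => coordVec φ a y) σ
    have h2 : leviCivita i j k l = (Equiv.Perm.sign σ : ℤ) := leviCivita_perm σ
    have h3 : (fun a => coordVec φ a y) ∘ ![0, 1, 2, 3] = fun a => coordVec φ a y := by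
      ext a; fin_cases a <;> rfl
    rw [e i j k l, e 0 1 2 3, h3, h2]
    have h4 : (fun a => coordVec φ a y) ∘ ![i, j, k, l] = (fun a => coordVec φ a y) ∘ σ := rfl
    rw [h4, h1]
    simp [Units.smul_def]
  · rw [leviCivita_of_not_injective i j k l h, e i j k l]
    have : ¬ Function.Injective ((fun a => coordVec φ a y) ∘ ![i, j, k, l]) := fun hc =>
      h hc.of_comp
    rw [AlternatingMap.map_eq_zero_of_not_injective _ _ this]
    simp

theorem comp2_g_symm (S : EMSpacetime M) (φ : Chart M) (i j : Fin 4) :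
    comp2 S.g φ i j = comp2 S.g φ j i := funext fun _ => S.g_symm _ _ _

/-- The matrix of the metric components. -/
def metricMatrix (S : EMSpacetime M) (φ : Chart M) (y : Coord) : Matrix (Fin 4) (Fin 4) ℝ :=
  Matrix.of fun i j => comp2 S.g φ i j y

theorem comp4_sq (S : EMSpacetime M) (φ : Chart M) (y : Coord) :
    comp4 S.vol φ 0 1 2 3 y ^ 2 = -(metricMatrix S φ y).det := by
  unfold comp4 metricMatrix
  rw [S.vol_metric]
  congr 2
  ext i j
  fin_cases i <;> fin_cases j <;> rfl

theorem sum_g_ginv {y : Coord} (hd : (metricMatrix S φ y).det ≠ 0) (i j : Fin 4) :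
    ∑ k, comp2 S.g φ i k y * S.ginv φ k j y = if i = j then 1 else 0 := by
  have := congrFun (congrFun (Matrix.mul_nonsing_inv (metricMatrix S φ y)
    (Ne.isUnit hd)) i) j
  rw [Matrix.one_apply] at this
  rw [← this, Matrix.mul_apply]
  rfl

theorem eq_zero_of_sum_g {y : Coord} (hd : (metricMatrix S φ y).det ≠ 0) {u : Fin 4 → ℝ}
    (h : ∀ i, ∑ k, comp2 S.g φ i k y * u k = 0) (k : Fin 4) : u k = 0 :=
  congrFun (Matrix.eq_zero_of_mulVec_eq_zero hd (funext h)) k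

/-- Christoffel symbols with the first index lowered. -/
theorem sum_g_Gam {y : Coord} (hd : (metricMatrix S φ y).det ≠ 0) (l i j : Fin 4) :
    ∑ k, comp2 S.g φ l k y * S.Gam φ k i j y = (1 / 2) *
      (pd i (comp2 S.g φ j l) y + pd j (comp2 S.g φ i l) y - pd l (comp2 S.g φ i j) y) := by
  have : ∀ k, comp2 S.g φ l k y * S.Gam φ k i j y = ∑ a, (comp2 S.g φ l k y * S.ginv φ k a y) *
      ((1 / 2) * (pd i (comp2 S.g φ j a) y + pd j (comp2 S.g φ i a) y
        - pd a (comp2 S.g φ i j) y)) := fun k => by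
    unfold EMSpacetime.Gam
    rw [Finset.mul_sum, Finset.mul_sum]
    exact Finset.sum_congr rfl fun a _ => by ring
  simp only [this]
  rw [Finset.sum_comm]
  simp only [← Finset.sum_mul, sum_g_ginv hd]
  simp

/-- In dimension four the factor ¼ of the second term of T meets the trace 4 of the metric, so the
two traces cancel. -/
theorem sum_stress {y : Coord} (hd : (metricMatrix S φ y).det ≠ 0) :
    ∑ i, ∑ j, S.ginv φ i j y * S.stress φ i j y = 0 ∧
    ∑ i, ∑ j, S.ginv φ i j y * comp2 S.g φ i j y = 4 := by
  have h4 : ∑ i, ∑ j, S.ginv φ i j y * comp2 S.g φ i j y = 4 := by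
    have : ∀ j, ∑ i, S.ginv φ i j y * comp2 S.g φ i j y = 1 := fun j => by
      have h := sum_g_ginv hd j j
      rw [if_pos rfl] at h
      rw [← h]
      exact Finset.sum_congr rfl fun i _ => by rw [comp2_g_symm S φ i j, mul_comm]
    rw [Finset.sum_comm]
    simp [this]
  refine ⟨?_, h4⟩
  have e : ∀ i j, S.ginv φ i j y * S.stress φ i j y =
      (∑ k, ∑ l, S.ginv φ i j y * S.ginv φ k l y * comp2 S.F φ i k y * comp2 S.F φ j l y) -
      (1 / 4) * (S.ginv φ i j y * comp2 S.g φ i j y) *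
        ∑ k, ∑ l, ∑ a, ∑ b, S.ginv φ k a y * S.ginv φ l b y *
          comp2 S.F φ k l y * comp2 S.F φ a b y := fun i j => by
    unfold EMSpacetime.stress
    rw [mul_sub, Finset.mul_sum]
    congr 1
    · refine Finset.sum_congr rfl fun k _ => ?_
      rw [Finset.mul_sum]
      exact Finset.sum_congr rfl fun l _ => by ring
    · ring
  simp only [e, Finset.sum_sub_distrib, ← Finset.sum_mul, ← Finset.mul_sum]
  rw [h4]
  have : ∑ i, ∑ j, ∑ k, ∑ l, S.ginv φ i j y * S.ginv φ k l y * comp2 S.F φ i k y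
      * comp2 S.F φ j l y = ∑ k, ∑ l, ∑ a, ∑ b, S.ginv φ k a y * S.ginv φ l b y *
          comp2 S.F φ k l y * comp2 S.F φ a b y :=
    Finset.sum_congr rfl fun i _ => Finset.sum_comm
  rw [this]
  ring

/-- Since the stress tensor is trace-free, `Ric = Λ g + κ₀ T`. -/
theorem ricci_eq_of_einstein {y : Coord} {κ₀ Λ : ℝ} (hd : (metricMatrix S φ y).det ≠ 0)
    (h : ∀ i j, S.ricci φ i j y - (1 / 2 : ℝ) * S.scal φ y * comp2 S.g φ i j y
      + Λ * comp2 S.g φ i j y = κ₀ * S.stress φ i j y) (i j : Fin 4) :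
    S.ricci φ i j y = Λ * comp2 S.g φ i j y + κ₀ * S.stress φ i j y := by
  obtain ⟨h0, h4⟩ := sum_stress hd
  -- Tracing the equations gives R - ½ R · 4 + 4 Λ = 0.
  have hs : S.scal φ y = 4 * Λ := by
    have e : ∀ i j, S.ginv φ i j y * S.ricci φ i j y = κ₀ * (S.ginv φ i j y * S.stress φ i j y) +
        ((1 / 2 : ℝ) * S.scal φ y - Λ) * (S.ginv φ i j y * comp2 S.g φ i j y) := fun i j => by
      linear_combination (S.ginv φ i j y) * h i j
    have h1 : S.scal φ y = ∑ i, ∑ j, S.ginv φ i j y * S.ricci φ i j y := rfl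
    simp only [e, Finset.sum_add_distrib, ← Finset.mul_sum, h0, h4] at h1
    linarith
  have := h i j
  rw [hs] at this
  linear_combination this

section Frame

variable {e : Fin 4 → Coord → Fin 4 → ℂ}

/-- The scalar products of an adapted null frame. -/
def nullProducts : Matrix (Fin 4) (Fin 4) ℂ :=
  !![0, 1, 0, 0; 1, 0, 0, 0; 0, 0, 0, -1; 0, 0, -1, 0]

theorem nullProducts_mul_self : nullProducts * nullProducts = 1 := by
  ext i j
  fin_cases i <;> fin_cases j <;> simp [nullProducts, Matrix.mul_apply, Fin.sum_univ_four]

/-- The matrix whose columns are the frame vectors. -/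
def frameMatrix (e : Fin 4 → Coord → Fin 4 → ℂ) (y : Coord) : Matrix (Fin 4) (Fin 4) ℂ :=
  Matrix.of fun j b => e b y j

/-- The matrix of the metric components, as complex numbers. -/
def metricMatrixC (S : EMSpacetime M) (φ : Chart M) (y : Coord) : Matrix (Fin 4) (Fin 4) ℂ :=
  (metricMatrix S φ y).map (algebraMap ℝ ℂ)

theorem frame_products (he : IsAdaptedFrame S φ e) {y : Coord} (hy : y ∈ φ.target) :
    (frameMatrix e y).transpose * metricMatrixC S φ y * frameMatrix e y = nullProducts := by
  ext a b
  have h := he.products y hy a b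
  unfold nullProducts
  rw [← h, Matrix.mul_apply]
  simp only [Matrix.mul_apply, gC, frameMatrix, metricMatrixC, metricMatrix, Matrix.transpose_apply,
    Matrix.of_apply, Matrix.map_apply, Finset.sum_mul]
  rw [Finset.sum_comm]
  exact Finset.sum_congr rfl fun i _ => Finset.sum_congr rfl fun j _ => by
    simp only [Complex.coe_algebraMap]; ring

theorem coframe_left_inverse (he : IsAdaptedFrame S φ e) {y : Coord} (hy : y ∈ φ.target) :
    (nullProducts * ((frameMatrix e y).transpose * metricMatrixC S φ y)) * frameMatrix e y = 1 := by
  rw [Matrix.mul_assoc, frame_products he hy, nullProducts_mul_self]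

/-- The coframe is the metric dual of the frame, relabelled by the constant matrix of scalar
products. It is thus polynomial in frame and metric, so its jets follow from theirs without
inverting a matrix. -/
theorem coframe_eq (he : IsAdaptedFrame S φ e) {y : Coord} (hy : y ∈ φ.target) (a k : Fin 4) :
    coframe e a k y = ∑ b, nullProducts a b * ∑ j, e b y j * (comp2 S.g φ j k y : ℂ) := by
  have := Matrix.inv_eq_left_inv (coframe_left_inverse he hy)
  have h := congrFun (congrFun this a) k
  unfold coframe
  rw [show (Matrix.of fun j b => e b y j) = frameMatrix e y from rfl, h, Matrix.mul_apply]
  refine Finset.sum_congr rfl fun b _ => ?_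
  rw [Matrix.mul_apply]
  rfl

theorem isUnit_frameMatrix (he : IsAdaptedFrame S φ e) {y : Coord} (hy : y ∈ φ.target) :
    IsUnit (frameMatrix e y).det :=
  Matrix.isUnit_det_of_left_inverse (coframe_left_inverse he hy)

theorem metricMatrix_det_ne (he : IsAdaptedFrame S φ e) {y : Coord} (hy : y ∈ φ.target) :
    (metricMatrix S φ y).det ≠ 0 := by
  intro h0
  have h := congrArg Matrix.det (coframe_left_inverse he hy)
  have h1 : (metricMatrixC S φ y).det = 0 := by
    have := RingHom.map_det (algebraMap ℝ ℂ) (metricMatrix S φ y)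
    rw [h0, map_zero] at this
    exact this.symm
  simp [Matrix.det_mul, h1] at h

theorem eq_zero_of_frame (he : IsAdaptedFrame S φ e) {y : Coord} (hy : y ∈ φ.target)
    {u : Fin 4 → ℝ} (h : ∀ a, ∑ k, (u k : ℂ) * e a y k = 0) (k : Fin 4) : u k = 0 := by
  have h1 : Matrix.vecMul (fun k => (u k : ℂ)) (frameMatrix e y) = 0 := funext h
  have := congrFun (Matrix.eq_zero_of_vecMul_eq_zero (isUnit_frameMatrix he hy).ne_zero h1) k
  exact Complex.ofReal_eq_zero.1 this

/-- Recovers the metric from the frame alone; applied on the horizon, where the frame is fixed by m.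
-/
theorem metricMatrixC_eq (he : IsAdaptedFrame S φ e) {y : Coord} (hy : y ∈ φ.target) :
    metricMatrixC S φ y = (frameMatrix e y)⁻¹.transpose * nullProducts * (frameMatrix e y)⁻¹ := by
  have hu := isUnit_frameMatrix he hy
  rw [← frame_products he hy, Matrix.transpose_nonsing_inv]
  have hu' : IsUnit (frameMatrix e y).transpose.det := by rwa [Matrix.det_transpose]
  simp only [Matrix.mul_assoc, Matrix.mul_nonsing_inv _ hu, Matrix.mul_one]
  rw [← Matrix.mul_assoc, Matrix.nonsing_inv_mul _ hu', Matrix.one_mul]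

theorem ginv_eq_frame (he : IsAdaptedFrame S φ e) {y : Coord} (hy : y ∈ φ.target) (i j : Fin 4) :
    (S.ginv φ i j y : ℂ) = ∑ a, ∑ b, e a y i * nullProducts a b * e b y j := by
  have hu := isUnit_frameMatrix he hy
  have h : metricMatrixC S φ y *
      (frameMatrix e y * nullProducts * (frameMatrix e y).transpose) = 1 := by
    rw [metricMatrixC_eq he hy]
    have hu' : IsUnit (frameMatrix e y).transpose.det := by rwa [Matrix.det_transpose]
    simp only [Matrix.mul_assoc]
    rw [← Matrix.mul_assoc _ (frameMatrix e y), Matrix.nonsing_inv_mul _ hu, Matrix.one_mul,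
      ← Matrix.mul_assoc nullProducts nullProducts, nullProducts_mul_self, Matrix.one_mul,
      Matrix.transpose_nonsing_inv, Matrix.nonsing_inv_mul _ hu']
  have h2 : metricMatrixC S φ y * ((metricMatrix S φ y)⁻¹.map (algebraMap ℝ ℂ)) = 1 := by
    unfold metricMatrixC
    rw [← Matrix.map_mul, Matrix.mul_nonsing_inv _ (Ne.isUnit (metricMatrix_det_ne he hy))]
    simp
  have h3 := (Matrix.inv_eq_right_inv h2).symm.trans (Matrix.inv_eq_right_inv h)
  have h4 := congrFun (congrFun h3 i) j
  simp only [Matrix.map_apply, Matrix.mul_apply, frameMatrix, Matrix.transpose_apply,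
    Matrix.of_apply, Finset.sum_mul] at h4
  rw [Finset.sum_comm] at h4
  exact h4

end Frame

end Reduction

/-! ### From a Killing horizon with Bondi-like chart to its coordinate form -/

section BoxOfHorizon

theorem hasDerivAt_radial {V : Type*} [NormedAddCommGroup V] [NormedSpace ℝ V] {W : Set Coord}
    (hW : IsOpen W) {f : Coord → V} (hf : ContDiffOn ℝ ∞ f W) (y : Coord) (t : ℝ)
    (hy : Function.update y 3 t ∈ W) :
    HasDerivAt (fun r => f (Function.update y 3 r)) (pd 3 f (Function.update y 3 t)) t :=
  (differentiableAt_of_contDiffOn hW hf hy).hasFDerivAt.comp_hasDerivAt t (hasDerivAt_update y 3 t)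

/-- Balls of `Coord` are cubes for the sup norm, so from a centre on the horizon every radial
segment lies in the ball and meets r = 0. -/
theorem update_mem_ball {p y : Coord} {ε t : ℝ} (hp : p 3 = 0) (hy : y ∈ Metric.ball p ε)
    (ht : |t| < ε) : Function.update y 3 t ∈ Metric.ball p ε := by
  have hε : 0 < ε := lt_of_le_of_lt (abs_nonneg t) ht
  rw [Metric.mem_ball, dist_pi_lt_iff hε] at hy ⊢
  intro i
  by_cases hi : i = 3
  · subst hi; simpa [hp, Real.dist_eq] using ht
  · rw [Function.update_of_ne hi]; exact hy i

theorem radial_const {p y : Coord} {ε : ℝ} {f : Coord → ℝ} (hp : p 3 = 0)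
    (hf : ContDiffOn ℝ ∞ f (Metric.ball p ε)) (h : ∀ y ∈ Metric.ball p ε, pd 3 f y = 0)
    (hy : y ∈ Metric.ball p ε) : f y = f (Function.update y 3 0) := by
  have hε : 0 < ε := Metric.pos_of_mem_ball hy
  have hm : ∀ t ∈ Metric.ball (0 : ℝ) ε, Function.update y 3 t ∈ Metric.ball p ε := fun t ht =>
    update_mem_ball hp hy (by simpa using ht)
  have hd : ∀ t ∈ Metric.ball (0 : ℝ) ε,
      HasDerivAt (fun r => f (Function.update y 3 r)) 0 t := fun t ht => by
    rw [← h _ (hm t ht)]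
    exact hasDerivAt_radial Metric.isOpen_ball hf y t (hm t ht)
  have hy3 : y 3 ∈ Metric.ball (0 : ℝ) ε := by
    rw [Metric.mem_ball, dist_pi_lt_iff hε] at hy
    simpa [hp] using hy 3
  have := Metric.isOpen_ball.is_const_of_deriv_eq_zero (convex_ball (0 : ℝ) ε).isPreconnected
    (fun t ht => (hd t ht).differentiableAt.differentiableWithinAt)
    (fun t ht => (hd t ht).deriv) hy3 (Metric.mem_ball_self hε)
  simpa using this

variable {M : Type*} [TopologicalSpace M] [ChartedSpace Coord M] {S : EMSpacetime M}
  {φ : Chart M} {H : Set M} {K : VField M} {e : Fin 4 → Coord → Fin 4 → ℂ} {p : Coord} {ε : ℝ}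

/-- Lowering the index in Γ^k_rr = 0 and using g_rr = 0 gives ∂_r g_rj = 0; the values at r = 0 are
the prescribed pullback of n. -/
theorem g_radial_of_bondi (hφ : IsBondiChart S H K φ) (he : IsAdaptedFrame S φ e)
    (hp : p 3 = 0) (hsub : Metric.ball p ε ⊆ φ.target) (j : Fin 4) :
    ∀ y ∈ Metric.ball p ε, comp2 S.g φ 3 j y = if j = 2 then 1 else 0 := by
  intro y hy
  have gs := fun i j => (S.g_smooth φ hφ.slice.1 i j).mono hsub
  have h33 : ∀ y ∈ Metric.ball p ε, comp2 S.g φ 3 3 y = 0 := fun y hy => hφ.n_null y (hsub hy)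
  have hd : ∀ y ∈ Metric.ball p ε, pd 3 (comp2 S.g φ 3 j) y = 0 := by
    intro y hy
    have h := sum_g_Gam (metricMatrix_det_ne he (hsub hy)) j 3 3
    simp only [hφ.n_geodesic y (hsub hy), mul_zero, Finset.sum_const_zero,
      pd_eq_zero_of_const Metric.isOpen_ball h33 j y hy] at h
    linarith
  have hε : 0 < ε := Metric.pos_of_mem_ball hy
  rw [radial_const hp (gs 3 j) hd hy]
  have hy0 := update_mem_ball hp hy (t := 0) (by simpa using hε)
  have hpb := hφ.n_pullback _ (hsub hy0) (by simp)
  fin_cases j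
  · have := hpb 0
    simp at this; simpa using this
  · have := hpb 1
    simp at this; simpa using this
  · have := hpb 2
    simp at this; simpa using this
  · simpa using h33 _ hy0

/-- In the gauge g_rj = δ_jv the (i, r) Killing equation reads g_ik ∂_r K^k + ∂_i K^v = 0. For i = r
it makes K^v constant in r, hence equal to 1; the rest is g_ik ∂_r K^k = 0, and g is non-degenerate.
-/
theorem killing_eq_pd_v (hH : IsKillingHorizon S H K) (hφ : IsBondiChart S H K φ)
    (he : IsAdaptedFrame S φ e) (hp : p 3 = 0) (hsub : Metric.ball p ε ⊆ φ.target) (k : Fin 4) :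
    ∀ y ∈ Metric.ball p ε, vcomp K φ k y = if k = 2 then 1 else 0 := by
  have hO : IsOpen (Metric.ball p ε) := Metric.isOpen_ball
  have ks := fun i => (hH.K_smooth φ hφ.slice.1 i).mono hsub
  have gr := g_radial_of_bondi hφ he hp hsub
  have gr' : ∀ j, ∀ y ∈ Metric.ball p ε, comp2 S.g φ j 3 y = if j = 2 then 1 else 0 := fun j => by
    rw [comp2_g_symm S φ j 3]; exact gr j
  have hor : ∀ k, (∀ y ∈ Metric.ball p ε, pd 3 (vcomp K φ k) y = 0) →
      ∀ y ∈ Metric.ball p ε, vcomp K φ k y = if k = 2 then 1 else 0 := by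
    intro k hk y hy
    have hε : 0 < ε := Metric.pos_of_mem_ball hy
    rw [radial_const hp (ks k) hk hy]
    exact hφ.ell _ (hsub (update_mem_ball hp hy (by simpa using hε))) (by simp) k
  have L : ∀ i, ∀ y ∈ Metric.ball p ε, ∑ k, comp2 S.g φ i k y * pd 3 (vcomp K φ k) y
      + pd i (vcomp K φ 2) y = 0 := by
    intro i y hy
    have h := hH.killing φ hφ.slice.1 y (hsub hy) i 3
    simp only [lie2, pd_eq_zero_of_const hO (gr' i) _ y hy, gr' _ y hy, Finset.sum_add_distrib,
      mul_zero, zero_add, ite_mul, one_mul, zero_mul,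
      Finset.sum_ite_eq', Finset.mem_univ, if_true] at h
    linarith
  have K2 := hor 2 (fun y hy => by
    have h := L 3 y hy
    simp only [gr _ y hy, ite_mul, one_mul, zero_mul, Finset.sum_ite_eq', Finset.mem_univ,
      if_true] at h
    linarith)
  refine hor k fun y hy => ?_
  refine eq_zero_of_sum_g (metricMatrix_det_ne he (hsub hy)) (u := fun k => pd 3 (vcomp K φ k) y)
    (fun i => ?_) k
  have h := L i y hy
  rw [pd_eq_zero_of_const hO K2 i y hy, add_zero] at h
  exact h

theorem stat_of_lie (hH : IsKillingHorizon S H K) (hφ : IsBondiChart S H K φ)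
    (he : IsAdaptedFrame S φ e) (hp : p 3 = 0) (hsub : Metric.ball p ε ⊆ φ.target)
    (T : Tensor2 M) (hT : ∀ y ∈ φ.target, ∀ i j, lie2 K T φ i j y = 0) (i j : Fin 4) :
    ∀ y ∈ Metric.ball p ε, pd 2 (comp2 T φ i j) y = 0 := by
  intro y hy
  have Kc := killing_eq_pd_v hH hφ he hp hsub
  have h := hT y (hsub hy) i j
  simpa [lie2, Kc _ y hy, pd_eq_zero_of_const Metric.isOpen_ball (Kc _) _ y hy] using h

theorem Gam_two (hφ : IsBondiChart S H K φ)
    (he : IsAdaptedFrame S φ e) (hp : p 3 = 0) (hsub : Metric.ball p ε ⊆ φ.target)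
    (i j : Fin 4) : ∀ y ∈ Metric.ball p ε, S.Gam φ 2 i j y = -(1 / 2) * pd 3 (comp2 S.g φ i j) y := by
  intro y hy
  have gr := g_radial_of_bondi hφ he hp hsub
  have gr' : ∀ j, ∀ y ∈ Metric.ball p ε, comp2 S.g φ j 3 y = if j = 2 then 1 else 0 := fun j => by
    rw [comp2_g_symm S φ j 3]; exact gr j
  have h := sum_g_Gam (metricMatrix_det_ne he (hsub hy)) 3 i j
  simp only [gr _ y hy, ite_mul, one_mul, zero_mul, Finset.sum_ite_eq', Finset.mem_univ,
    if_true, pd_eq_zero_of_const Metric.isOpen_ball (gr' _) _ y hy] at h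
  rw [h]; ring

/-- On the horizon this reads ω_i = -½ ∂_r g_iv for tangential i, and in particular κ = -½ ∂_r g_vv.
It converts the rotation form and the surface gravity into first radial derivatives of the metric.
-/
theorem nablaV_two (hH : IsKillingHorizon S H K) (hφ : IsBondiChart S H K φ)
    (he : IsAdaptedFrame S φ e) (hp : p 3 = 0) (hsub : Metric.ball p ε ⊆ φ.target) (i : Fin 4) :
    ∀ y ∈ Metric.ball p ε, S.nablaV K φ i 2 y = -(1 / 2) * pd 3 (comp2 S.g φ i 2) y := by
  intro y hy
  have Kc := killing_eq_pd_v hH hφ he hp hsub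
  simp [EMSpacetime.nablaV, Kc _ y hy, pd_eq_zero_of_const Metric.isOpen_ball (Kc _) _ y hy,
    Gam_two hφ he hp hsub i 2 y hy]

/-- On the horizon ∂_v = e₄ has product -1 with n and 0 with the other frame vectors. The covector
dr takes the same values on the frame, so g(∂_v, ·) = dr. -/
theorem g_null_of_frame (hφ : IsBondiChart S H K φ) (he : IsAdaptedFrame S φ e)
    (hp : p 3 = 0) (hsub : Metric.ball p ε ⊆ φ.target) {y : Coord} (hy : y ∈ Metric.ball p ε)
    (h3 : y 3 = 0) (j : Fin 4) : comp2 S.g φ 2 j y = if j = 3 then 1 else 0 := by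
  have hyt := hsub hy
  have gr := g_radial_of_bondi hφ he hp hsub
  have hl := he.ell_horizon y hyt h3
  have hn := he.n_eq y hyt
  have hp4 : ∀ a, ∑ i, (comp2 S.g φ 2 i y : ℂ) * e a y i = if a = 2 then -1 else 0 := by
    intro a
    have h := he.products y hyt 3 a
    have h1 : gC S φ y (e 3 y) (e a y) = ∑ i, (comp2 S.g φ 2 i y : ℂ) * e a y i := by
      simp [gC, hl, Fin.sum_univ_four]
    rw [h1] at h
    rw [h]
    fin_cases a <;> simp
  have := eq_zero_of_frame he hyt (u := fun k => comp2 S.g φ 2 k y - if k = 3 then 1 else 0)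
    (fun a => ?_) j
  · linarith
  · have h := hp4 a
    have h2 : e a y 3 = if a = 2 then -1 else 0 := by
      fin_cases a
      · exact (he.m_tangent y hyt h3).2
      · have := he.conj_m y hyt 3
        rw [(he.m_tangent y hyt h3).2] at this
        simpa using this
      · simpa using hn 3
      · simpa using hl 3
    rw [Fin.sum_univ_four] at h
    simp [Fin.sum_univ_four] 
    linear_combination h - h2

theorem horizonBox_of_killingHorizon {κ₀ Λ : ℝ} {κ : M → ℝ} (hS : S.IsElectrovac κ₀ Λ)
    (hH : IsKillingHorizon S H K) (hκ : IsSurfaceGravity S H K κ) (hκ_ne : ∀ q ∈ H, κ q ≠ 0)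
    (hφ : IsBondiChart S H K φ) (he : IsAdaptedFrame S φ e)
    (hp : p 3 = 0) (hsub : Metric.ball p ε ⊆ φ.target) :
    HorizonBox S φ κ₀ Λ (Metric.ball p ε) := by
  have gr := g_radial_of_bondi hφ he hp hsub
  have gr' : ∀ j, ∀ y ∈ Metric.ball p ε, comp2 S.g φ j 3 y = if j = 2 then 1 else 0 := fun j => by
    rw [comp2_g_symm S φ j 3]; exact gr j
  -- The gauge gives det g = -det g_AB, to be combined with the Gram identity for the volume form.
  have hvol : ∀ y ∈ Metric.ball p ε,
      comp4 S.vol φ 0 1 2 3 y * comp4 S.vol φ 0 1 2 3 y = areaDet S φ y := by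
    intro y hy
    rw [← pow_two, comp4_sq, Matrix.det_succ_row_zero]
    simp [Fin.sum_univ_four, Matrix.det_fin_three, metricMatrix, gr _ y hy, gr' _ y hy,
      Fin.succAbove, areaDet, comp2_g_symm S φ 1 0]
    try ring
  have hphi := hφ.slice.1
  refine
    { isOpen := Metric.isOpen_ball
      g_smooth := fun i j => (S.g_smooth φ hphi i j).mono hsub
      F_smooth := fun i j => (S.F_smooth φ hphi i j).mono hsub
      vol_smooth := (S.vol_smooth φ hphi 0 1 2 3).mono hsub
      g_symm := comp2_g_symm S φ
      F_antisymm := fun i j y => S.F_antisymm _ _ _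
      g_radial := gr
      g_stat := stat_of_lie hH hφ he hp hsub S.g (hH.killing φ hphi)
      F_stat := stat_of_lie hH hφ he hp hsub S.F (hH.lie_F φ hphi)
      vol_comp := comp4_eq S.vol φ
      vol_sq := hvol
      areaDet_ne := fun y hy => ?_
      ricci_eq := fun i j y hy => ricci_eq_of_einstein (metricMatrix_det_ne he (hsub hy))
        (hS.einstein φ hphi y (hsub hy)) i j
      maxwell := fun i j k y hy => hS.maxwell φ hphi y (hsub hy) i j k
      maxwell_star := fun i j k y hy => hS.maxwell_star φ hphi y (hsub hy) i j k
      g_null := fun y hy h3 j hj => by rw [g_null_of_frame hφ he hp hsub hy h3, if_neg hj]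
      surfaceGravity_ne := fun y hy h3 h0 => ?_ }
  · rw [← hvol y hy, ← pow_two, comp4_sq]
    exact neg_ne_zero.2 (metricMatrix_det_ne he (hsub hy))
  · have hyt := hsub hy
    have hin : φ.symm y ∈ H := by
      rw [hφ.slice.2 _ (φ.map_target hyt), φ.right_inv hyt]; exact h3
    have h := hκ φ hphi y hyt hin 2
    simp only [hφ.ell y hyt h3, ite_mul, one_mul, zero_mul, Finset.sum_ite_eq', Finset.mem_univ,
      if_true, mul_one, nablaV_two hH hφ he hp hsub 2 y hy, h0, mul_zero] at h
    exact hκ_ne _ hin h.symm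

end BoxOfHorizon

/-! ### Vanishing of Ric(ℓ,ℓ) and of F(ℓ,·) on the horizon -/

section NullComponents

variable {M : Type*} [TopologicalSpace M] [ChartedSpace Coord M] {S : EMSpacetime M}
  {φ : Chart M} {κ₀ Λ : ℝ} {W : Set Coord}

namespace HorizonBox

theorem ginv_three_null (B : HorizonBox S φ κ₀ Λ W) {y : Coord} (hy : y ∈ W) (h3 : y 3 = 0)
    {j : Fin 4} (hj : j ≠ 2) : S.ginv φ 3 j y = 0 := by
  refine (jet_ginv B B (B.metricJet_self 0) 3 j).van.eq_zero ?_ hy h3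
  revert j; decide

theorem ginv_three_two (B : HorizonBox S φ κ₀ Λ W) {y : Coord} (hy : y ∈ W) :
    S.ginv φ 3 2 y = 1 := by rw [B.ginv_eq hy]; rfl

/-- Raychaudhuri's equation: `Ric(ℓ, ℓ) = 0` on the horizon. -/
theorem ricci_null (B : HorizonBox S φ κ₀ Λ W) {y : Coord} (hy : y ∈ W) (h3 : y 3 = 0) :
    S.ricci φ 2 2 y = 0 := by
  have hW := B.isOpen
  have G := B.metricJet_self 0
  have I := jet_ginv B B G
  have Γ := jet_Gam B B (by decide) (by decide) (by decide) G
  have Γ0 : ∀ k i j, 1 ≤ (oGam 9 9 9 k i j).1 → S.Gam φ k i j y = 0 := fun k i j h =>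
    (Γ k i j).van.eq_zero h hy h3
  have e2 : S.Gam φ 2 2 2 y = -(1 / 2) * pd 3 (comp2 S.g φ 2 2) y := by
    simp [EMSpacetime.Gam, B.ginv_two hy, B.g_stat _ _ y hy]
  have e3 : S.Gam φ 3 2 3 y = (1 / 2) * pd 3 (comp2 S.g φ 2 2) y := by
    simp [EMSpacetime.Gam, Fin.sum_univ_four, B.ginv_three_null hy h3, B.ginv_three_two hy,
      B.g_stat _ _ y hy]
  have q1 : ∑ k, ∑ l, S.Gam φ k k l y * S.Gam φ l 2 2 y = 0 := by
    have T := Jet.sum hW fun l => (jet_trace B B (by decide) (by decide) (by decide) G l).mul hW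
      (Γ l 2 2)
    have := T.van.eq_zero (by decide +kernel) hy h3
    rw [Finset.sum_comm]
    simpa only [Finset.sum_mul] using this
  have q2 : ∑ k, ∑ l, S.Gam φ k 2 l y * S.Gam φ l 2 k y =
      (1 / 2) * (pd 3 (comp2 S.g φ 2 2) y * pd 3 (comp2 S.g φ 2 2) y) := by
    simp only [Fin.sum_univ_four, Γ0 0 2 0 (by decide +kernel), Γ0 0 2 1 (by decide +kernel),
      Γ0 0 2 2 (by decide +kernel), Γ0 1 2 0 (by decide +kernel), Γ0 1 2 1 (by decide +kernel),
      Γ0 1 2 2 (by decide +kernel), Γ0 2 2 3 (by decide +kernel), Γ0 3 2 0 (by decide +kernel),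
      Γ0 3 2 1 (by decide +kernel), Γ0 3 2 2 (by decide +kernel), e2, e3]
    ring
  have dA : ∀ k, k < 2 → pd k (S.Gam φ k 2 2) y = 0 := by
    intro k hk
    refine ((Γ k 2 2).pd_of_ne hW (i := k) (by rintro rfl; exact absurd hk (by decide))).van.eq_zero
      ?_ hy h3
    revert k; decide +kernel
  -- In Γ^r_vv = -½ g^{rl} ∂_l g_vv the terms l = A have double zeros. The term l = r contributes
  -- through ∂_r g^{rr} = -∂_r g_vv, and the result cancels against `q2`.
  have d3 : pd 3 (S.Gam φ 3 2 2) y = (1 / 2) *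
      (pd 3 (comp2 S.g φ 2 2) y * pd 3 (comp2 S.g φ 2 2) y) := by
    have sg := fun l => contDiffOn_pd hW (B.g_smooth 2 2) l
    have sI := fun l => (I 3 l).smooth
    have sc : ContDiffOn ℝ ∞ (fun _ : Coord => (-(1 / 2) : ℝ)) W := contDiffOn_const
    have eq : Set.EqOn (S.Gam φ 3 2 2) (fun z => -(1 / 2) *
        ((S.ginv φ 3 0 z * pd 0 (comp2 S.g φ 2 2) z + S.ginv φ 3 1 z * pd 1 (comp2 S.g φ 2 2) z)
          + S.ginv φ 3 3 z * pd 3 (comp2 S.g φ 2 2) z)) W := fun z hz => by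
      simp only [EMSpacetime.Gam, Fin.sum_univ_four, B.g_stat _ _ z hz]
      ring
    have v : ∀ l, l < 2 → pd 3 (fun z => S.ginv φ 3 l z * pd l (comp2 S.g φ 2 2) z) y = 0 := by
      intro l hl
      have hl3 : l ≠ 3 := by rintro rfl; exact absurd hl (by decide)
      have h1 : VanOn W 1 (S.ginv φ 3 l) := (I 3 l).van.mono (by revert l; decide)
      have h2 := (B.vanOn_g_two (j := 2) (by decide)).pd_of_ne hW (B.g_smooth 2 2) hl3
      exact (h1.mul hW h2 (sI l) (sg l)).2.1 y hy h3
    have s0 := (sI 0).mul (sg 0)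
    have s1 := (sI 1).mul (sg 1)
    have s3 := (sI 3).mul (sg 3)
    rw [pd_congr hW eq 3 hy, pd_mul hW sc ((s0.add s1).add s3) 3 hy, pd_add hW (s0.add s1) s3 3 hy,
      pd_add hW s0 s1 3 hy, v 0 (by decide), v 1 (by decide), pd_mul hW (sI 3) (sg 3) 3 hy,
      B.pd_ginv_three hy h3, B.ginv_three_null hy h3 (j := 3) (by decide)]
    have : pd 3 (fun _ : Coord => (-(1 / 2) : ℝ)) y = 0 := by simp [pd]
    rw [this]
    ring
  unfold EMSpacetime.ricci
  simp only [Finset.sum_sub_distrib, q1, q2, (B.stat_Gam _ _ _).2 y hy, Finset.sum_const_zero]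
  rw [Fin.sum_univ_four, dA 0 (by decide), dA 1 (by decide), (B.stat_Gam _ _ _).2 y hy, d3]
  ring

/-- The Einstein equations force `F(ℓ, X) = 0` for `X` tangent to the horizon. -/
theorem field_null (B : HorizonBox S φ κ₀ Λ W) (hκ₀ : κ₀ ≠ 0) {e : Fin 4 → Coord → Fin 4 → ℂ}
    (he : IsAdaptedFrame S φ e) (hsub : W ⊆ φ.target) {y : Coord} (hy : y ∈ W) (h3 : y 3 = 0)
    {j : Fin 4} (hj : j ≠ 3) : comp2 S.F φ 2 j y = 0 := by
  have hyt := hsub hy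
  have hm := he.m_tangent y hyt h3
  have hl := he.ell_horizon y hyt h3
  have hn := he.n_eq y hyt
  have hc := he.conj_m y hyt
  have hs : S.stress φ 2 2 y = 0 := by
    have h := B.ricci_eq 2 2 y hy
    rw [B.ricci_null hy h3, B.g_null y hy h3 2 (by decide), mul_zero, zero_add] at h
    exact (mul_eq_zero.1 h.symm).resolve_left hκ₀
  have n3 : ∀ k, k ≠ 2 → S.ginv φ k 3 y = 0 := fun k hk => by
    rw [B.ginv_symm k 3 hy, B.ginv_three_null hy h3 hk]
  have n2 : ∀ k, S.ginv φ k 2 y = if k = 3 then 1 else 0 := fun k => by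
    rw [B.ginv_symm k 2 hy, B.ginv_two hy]
  have hq : S.ginv φ 0 0 y * comp2 S.F φ 2 0 y * comp2 S.F φ 2 0 y
      + S.ginv φ 0 1 y * comp2 S.F φ 2 0 y * comp2 S.F φ 2 1 y
      + (S.ginv φ 1 0 y * comp2 S.F φ 2 1 y * comp2 S.F φ 2 0 y
      + S.ginv φ 1 1 y * comp2 S.F φ 2 1 y * comp2 S.F φ 2 1 y) = 0 := by
    rw [← hs]
    unfold EMSpacetime.stress
    rw [B.g_null y hy h3 2 (by decide)]
    simp [Fin.sum_univ_four, B.ginv_three_null hy h3, n2, n3, B.F_self, B.ginv_two hy]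
  have hI : ∀ i j, i < 2 → j < 2 → (S.ginv φ i j y : ℂ) =
      e 0 y i * e 1 y j + e 1 y i * e 0 y j := by
    intro i j hi hj
    have hi' : i ≠ 3 ∧ i ≠ 2 := by revert i; decide
    have hj' : j ≠ 3 ∧ j ≠ 2 := by revert j; decide
    rw [ginv_eq_frame he hyt]
    simp [Fin.sum_univ_four, nullProducts, hn, hl, hi', hj']
  -- z = F(ℓ, m). With g^{AB} = m^A m̄^B + m̄^A m^B the identity `hq` becomes 2 |z|² = 0.
  set z : ℂ := e 0 y 0 * comp2 S.F φ 2 0 y + e 0 y 1 * comp2 S.F φ 2 1 y with hz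
  have hcz : starRingEnd ℂ z = e 1 y 0 * comp2 S.F φ 2 0 y + e 1 y 1 * comp2 S.F φ 2 1 y := by
    simp [hz, hc]
  have hzz : z * starRingEnd ℂ z = 0 := by
    have h := congrArg (fun t : ℝ => (t : ℂ)) hq
    push_cast at h
    rw [hI 0 0 (by decide) (by decide), hI 0 1 (by decide) (by decide),
      hI 1 0 (by decide) (by decide), hI 1 1 (by decide) (by decide)] at h
    rw [hcz, hz]
    linear_combination (1 / 2) * h
  have hz0 : z = 0 := by
    rcases mul_eq_zero.1 hzz with h | h
    · exact h
    · simpa using h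
  have hcz0 := hcz
  rw [hz0, map_zero] at hcz0
  rw [hz0] at hz
  -- The covector F(ℓ, ·) with its r-component removed annihilates m and m̄ because z = 0, ℓ by
  -- antisymmetry, and n because n has only an r-component.
  have key := eq_zero_of_frame he hyt
    (u := fun k => if k = 3 then 0 else comp2 S.F φ 2 k y) (fun a => ?_) j
  · simpa [hj] using key
  · fin_cases a
    · simp [Fin.sum_univ_four, B.F_self]; linear_combination -hz
    · simp [Fin.sum_univ_four, B.F_self]; linear_combination -hcz0
    · simp [hn]
    · simp [B.F_self, hl]

end HorizonBox

end NullComponents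

/-! ### Agreement to all orders, and iterated radial derivatives -/

section Agreement

/-- Agreement of all radial derivatives at the horizon. -/
def JetAll {𝕜 : Type*} [NormedField 𝕜] [NormedAlgebra ℝ 𝕜] (W : Set Coord)
    (f f' : Coord → 𝕜) : Prop :=
  ∀ n, Jet W n (0, 1) f f'

variable {W : Set Coord}

theorem pd_ofReal {f : Coord → ℝ} (hW : IsOpen W) (hf : ContDiffOn ℝ ∞ f W) (i : Fin 4)
    {y : Coord} (hy : y ∈ W) : pd i (fun z => (f z : ℂ)) y = ((pd i f y : ℝ) : ℂ) := by
  have h := Complex.ofRealCLM.hasFDerivAt.comp y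
    (differentiableAt_of_contDiffOn hW hf hy).hasFDerivAt
  have h2 : fderiv ℝ (fun z => (f z : ℂ)) y = Complex.ofRealCLM.comp (fderiv ℝ f y) := h.fderiv
  simp [pd, h2]

theorem contDiffOn_ofReal {f : Coord → ℝ} (hf : ContDiffOn ℝ ∞ f W) :
    ContDiffOn ℝ ∞ (fun z => (f z : ℂ)) W :=
  Complex.ofRealCLM.contDiff.comp_contDiffOn hf

theorem VanOn.ofReal (hW : IsOpen W) {n : ℕ} {f : Coord → ℝ} (hf : ContDiffOn ℝ ∞ f W)
    (h : VanOn W n f) : VanOn W n (fun z => (f z : ℂ)) := by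
  induction n generalizing f with
  | zero => trivial
  | succ n ih =>
    exact ⟨fun y hy h3 => by simp [h.1 y hy h3],
      (ih (contDiffOn_pd hW hf 3) h.2).congr hW fun y hy => (pd_ofReal hW hf 3 hy).symm⟩

theorem Jet.ofReal (hW : IsOpen W) {n : ℕ} {s : ℕ × ℕ} {f f' : Coord → ℝ} (h : Jet W n s f f') :
    Jet W n s (fun z => (f z : ℂ)) (fun z => (f' z : ℂ)) :=
  ⟨contDiffOn_ofReal h.smooth, contDiffOn_ofReal h.smooth', h.van.ofReal hW h.smooth,
    h.van'.ofReal hW h.smooth', (h.diff.ofReal hW (h.smooth.sub h.smooth')).congr hW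
      fun y _ => by push_cast; rfl⟩

variable {𝕜 : Type*} [NormedField 𝕜] [NormedAlgebra ℝ 𝕜]

theorem JetAll.mul (hW : IsOpen W) {f f' g g' : Coord → 𝕜} (h : JetAll W f f')
    (h2 : JetAll W g g') : JetAll W (fun y => f y * g y) (fun y => f' y * g' y) :=
  fun n => (h n).mul hW (h2 n)

theorem JetAll.add (hW : IsOpen W) {f f' g g' : Coord → 𝕜} (h : JetAll W f f')
    (h2 : JetAll W g g') : JetAll W (fun y => f y + g y) (fun y => f' y + g' y) :=
  fun n => (h n).add hW (h2 n)

theorem JetAll.const_mul (hW : IsOpen W) {f f' : Coord → 𝕜} (c : 𝕜) (h : JetAll W f f') :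
    JetAll W (fun y => c * f y) (fun y => c * f' y) :=
  fun n => (h n).const_mul hW c

theorem JetAll.sum (hW : IsOpen W) {f f' : Fin 4 → Coord → 𝕜} (h : ∀ i, JetAll W (f i) (f' i)) :
    JetAll W (fun y => ∑ i, f i y) (fun y => ∑ i, f' i y) :=
  fun n => Jet.sum hW fun i => h i n

theorem JetAll.congr (hW : IsOpen W) {f f' g g' : Coord → 𝕜} (h : JetAll W f f')
    (e : Set.EqOn f g W) (e' : Set.EqOn f' g' W) : JetAll W g g' :=
  fun n => (h n).congr hW e e'

theorem onHorizon_update (h : Fin 3 → ℝ) (r : ℝ) :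
    ![h 0, h 1, h 2, r] = Function.update (onHorizon h) 3 r := by
  ext i; fin_cases i <;> rfl

/-- Along the radial line ordinary derivatives are those of `pd 3`. This holds only while the line
stays in W, hence the eventual equality near r = 0. -/
theorem radialDeriv_eq {f f' : Coord → ℂ} (hW : IsOpen W) {h : Fin 3 → ℝ} (hh : onHorizon h ∈ W)
    {n : ℕ} (sf : ContDiffOn ℝ ∞ f W) (sf' : ContDiffOn ℝ ∞ f' W)
    (hv : VanOn W (n + 1) fun y => f y - f' y) : radialDeriv n f h = radialDeriv n f' h := by
  have hu : Function.update (onHorizon h) 3 0 = onHorizon h := (onHorizon_update h 0).symm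
  induction n generalizing f f' with
  | zero =>
    have := hv.1 _ hh rfl
    simp only [radialDeriv, iteratedDeriv_zero, onHorizon_update, hu]
    exact sub_eq_zero.1 this
  | succ n ih =>
    have key : ∀ f : Coord → ℂ, ContDiffOn ℝ ∞ f W →
        radialDeriv (n + 1) f h = radialDeriv n (pd 3 f) h := by
      intro f sf
      simp only [radialDeriv, iteratedDeriv_succ', onHorizon_update]
      refine Filter.EventuallyEq.iteratedDeriv_eq n ?_
      have hc : Continuous fun r : ℝ => Function.update (onHorizon h) 3 r :=
        continuous_const.update 3 continuous_id
      have hm : ∀ᶠ r in nhds (0 : ℝ), Function.update (onHorizon h) 3 r ∈ W :=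
        hc.continuousAt.preimage_mem_nhds (hW.mem_nhds (by rwa [hu]))
      filter_upwards [hm] with r hr
      exact (hasDerivAt_radial hW sf _ r hr).deriv
    rw [key f sf, key f' sf']
    refine ih (contDiffOn_pd hW sf 3) (contDiffOn_pd hW sf' 3) ?_
    exact hv.2.congr hW fun y hy => pd_sub hW sf sf' 3 hy

theorem JetAll.radialDeriv_eq {f f' : Coord → ℂ} (hW : IsOpen W) {h : Fin 3 → ℝ}
    (hh : onHorizon h ∈ W) (hf : JetAll W f f') (n : ℕ) :
    radialDeriv n f h = radialDeriv n f' h :=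
  EMHorizon.radialDeriv_eq hW hh (hf n).smooth (hf n).smooth' (hf n).diff

end Agreement

/-! ### Jets of frame, coframe and Maxwell scalars -/

section Frames

variable {M M' : Type*} [TopologicalSpace M] [ChartedSpace Coord M] [TopologicalSpace M']
  [ChartedSpace Coord M'] {S : EMSpacetime M} {S' : EMSpacetime M'} {φ : Chart M} {φ' : Chart M'}
  {W : Set Coord} {e e' : Fin 4 → Coord → Fin 4 → ℂ}

/-- The frame is parallel along `-∂_r`. -/
theorem pd_frame (he : IsAdaptedFrame S φ e) {y : Coord} (hy : y ∈ φ.target) (a k : Fin 4) :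
    pd 3 (fun z => e a z k) y = -1 * ∑ j, (S.Gam φ k 3 j y : ℂ) * e a y j := by
  have h := he.parallel y hy a k
  simp only [he.n_eq y hy, ite_mul, zero_mul, Finset.sum_ite_eq', Finset.mem_univ, if_true] at h
  linear_combination -h

/-- Parallel transport is the linear radial equation ∂_r e = -Γ e. As the Γ agree to all orders,
each order of agreement of e yields the next, starting from equality on the horizon. -/
theorem jetAll_frame (hW : IsOpen W) (hsub : W ⊆ φ.target) (hsub' : W ⊆ φ'.target)
    (he : IsAdaptedFrame S φ e) (he' : IsAdaptedFrame S' φ' e')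
    (Γ : ∀ k i j, JetAll W (S.Gam φ k i j) (S'.Gam φ' k i j))
    (h0 : ∀ y ∈ W, y 3 = 0 → ∀ a k, e a y k = e' a y k) (a k : Fin 4) :
    JetAll W (fun y => e a y k) (fun y => e' a y k) := by
  intro n
  induction n generalizing a k with
  | zero =>
    exact ⟨(he.smooth a k).mono hsub, (he'.smooth a k).mono hsub', trivial, trivial,
      fun y hy h3 => sub_eq_zero.2 (h0 y hy h3 a k), trivial⟩
  | succ n ih =>
    have d : Jet W n (0, 1) _ _ := (Jet.sum hW fun j =>
      ((Γ k 3 j n).ofReal hW).mul hW (ih a j)).const_mul hW (-1)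
    have d' := d.congr hW (fun y hy => (pd_frame he (hsub hy) a k).symm)
      (fun y hy => (pd_frame he' (hsub' hy) a k).symm)
    have h := (ih a k).of_pd_three (s := (0, 1)) hW (k := 1) d'.diff
    exact ⟨h.smooth, h.smooth', trivial, trivial, h.diff⟩

theorem jetAll_coframe (hW : IsOpen W) (hsub : W ⊆ φ.target) (hsub' : W ⊆ φ'.target)
    (he : IsAdaptedFrame S φ e) (he' : IsAdaptedFrame S' φ' e')
    (G : ∀ i j, JetAll W (comp2 S.g φ i j) (comp2 S'.g φ' i j))
    (E : ∀ a k, JetAll W (fun y => e a y k) (fun y => e' a y k)) (a k : Fin 4) :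
    JetAll W (coframe e a k) (coframe e' a k) := by
  refine (JetAll.sum hW fun b => (JetAll.sum hW fun j => (E b j).mul hW
    (g := fun y => (comp2 S.g φ j k y : ℂ)) (g' := fun y => (comp2 S'.g φ' j k y : ℂ))
    fun n => (G j k n).ofReal hW).const_mul hW (nullProducts a b)).congr hW
    (fun y hy => (coframe_eq he (hsub hy) a k).symm)
    (fun y hy => (coframe_eq he' (hsub' hy) a k).symm)

theorem jetAll_FC (hW : IsOpen W)
    (F : ∀ i j, JetAll W (comp2 S.F φ i j) (comp2 S'.F φ' i j))
    (E : ∀ a k, JetAll W (fun y => e a y k) (fun y => e' a y k)) (a b : Fin 4) :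
    JetAll W (fun y => FC S φ y (e a y) (e b y)) (fun y => FC S' φ' y (e' a y) (e' b y)) :=
  JetAll.sum hW fun i => JetAll.sum hW fun j => (JetAll.mul hW
    (f := fun y => (comp2 S.F φ i j y : ℂ)) (f' := fun y => (comp2 S'.F φ' i j y : ℂ))
    (fun n => (F i j n).ofReal hW) (E a i)).mul hW (E b j)

theorem jetAll_maxwellScalar (hW : IsOpen W)
    (F : ∀ i j, JetAll W (comp2 S.F φ i j) (comp2 S'.F φ' i j))
    (E : ∀ a k, JetAll W (fun y => e a y k) (fun y => e' a y k)) (I : Fin 3) :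
    JetAll W (maxwellScalar S φ e I) (maxwellScalar S' φ' e' I) := by
  have h := jetAll_FC hW F E
  fin_cases I
  · exact h 3 0
  · exact ((h 3 2).add hW (h 1 0)).const_mul hW (1 / 2)
  · exact h 1 2

end Frames

/-! ### Base case: what the horizon data determine at lowest order -/

section HorizonData

variable {M M' : Type*} [TopologicalSpace M] [ChartedSpace Coord M] [TopologicalSpace M']
  [ChartedSpace Coord M'] {S : EMSpacetime M} {S' : EMSpacetime M'} {φ : Chart M} {φ' : Chart M'}
  {κ₀ Λ : ℝ} {W : Set Coord} {e e' : Fin 4 → Coord → Fin 4 → ℂ}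

theorem g_eq_of_frame_eq (he : IsAdaptedFrame S φ e) (he' : IsAdaptedFrame S' φ' e') {y : Coord}
    (hy : y ∈ φ.target) (hy' : y ∈ φ'.target) (h : ∀ a k, e a y k = e' a y k) (i j : Fin 4) :
    comp2 S.g φ i j y = comp2 S'.g φ' i j y := by
  have hE : frameMatrix e y = frameMatrix e' y := by
    ext i j; exact h j i
  have h1 : metricMatrixC S φ y = metricMatrixC S' φ' y := by
    rw [metricMatrixC_eq he hy, metricMatrixC_eq he' hy', hE]
  exact Complex.ofReal_injective (congrFun (congrFun h1 i) j)

/-- The metric fixes the volume form up to sign, and the sign is fixed because the same frame is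
positively oriented in both spacetimes. -/
theorem vol_eq_of_frame_eq (he : IsAdaptedFrame S φ e) (he' : IsAdaptedFrame S' φ' e') {y : Coord}
    (hy : y ∈ φ.target) (hy' : y ∈ φ'.target) (h : ∀ a k, e a y k = e' a y k) :
    comp4 S.vol φ 0 1 2 3 y = comp4 S'.vol φ' 0 1 2 3 y := by
  have hm : metricMatrix S φ y = metricMatrix S' φ' y := by
    ext i j; exact g_eq_of_frame_eq he he' hy hy' h i j
  have hsq : comp4 S.vol φ 0 1 2 3 y ^ 2 = comp4 S'.vol φ' 0 1 2 3 y ^ 2 := by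
    rw [comp4_sq, comp4_sq, hm]
  have o := he.oriented y hy
  have o' := he'.oriented y hy'
  simp only [← h] at o'
  rcases sq_eq_sq_iff_eq_or_eq_neg.1 hsq with h1 | h1
  · exact h1
  · exfalso
    have hneg : ∀ i j k l, comp4 S.vol φ i j k l y = -comp4 S'.vol φ' i j k l y := fun i j k l => by
      rw [comp4_eq S.vol, comp4_eq S'.vol, h1]; ring
    simp only [hneg, neg_mul, Finset.sum_neg_distrib] at o
    linarith

/-- Agreement to lowest order of the metric components. -/
theorem metricJet_zero (B : HorizonBox S φ κ₀ Λ W) (B' : HorizonBox S' φ' κ₀ Λ W)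
    (hg : ∀ y ∈ W, y 3 = 0 → ∀ i j, comp2 S.g φ i j y = comp2 S'.g φ' i j y)
    (hdg : ∀ y ∈ W, y 3 = 0 → ∀ j, j ≠ 3 →
      pd 3 (comp2 S.g φ 2 j) y = pd 3 (comp2 S'.g φ' 2 j) y) :
    MetricJet S S' φ φ' W 0 1 2 2 := by
  have main : ∀ j, j ≠ 3 → Jet W 0 (1, 2) (comp2 S.g φ 2 j) (comp2 S'.g φ' 2 j) := fun j hj =>
    ⟨B.g_smooth 2 j, B'.g_smooth 2 j, B.vanOn_g_two hj, B'.vanOn_g_two hj,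
      fun y hy h3 => sub_eq_zero.2 (hg y hy h3 2 j), fun y hy h3 => by
        rw [pd_sub B.isOpen (B.g_smooth 2 j) (B'.g_smooth 2 j) 3 hy]
        exact sub_eq_zero.2 (hdg y hy h3 j hj), trivial⟩
  refine metricJet_of_ne B B' fun i j hi hj => ?_
  by_cases h2 : i = 2
  · subst h2
    exact (main j hj).mono (by revert j; decide)
  by_cases h2' : j = 2
  · subst h2'
    rw [B.g_symm i 2, B'.g_symm i 2]
    exact (main i hi).mono (by revert i; decide)
  · have : Jet W 0 (0, 1) (comp2 S.g φ i j) (comp2 S'.g φ' i j) :=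
      ⟨B.g_smooth i j, B'.g_smooth i j, trivial, trivial,
        fun y hy h3 => sub_eq_zero.2 (hg y hy h3 i j), trivial⟩
    exact this.mono (by clear this; revert i j; decide)

/-- Agreement to lowest order of the field components. -/
theorem fieldJet_zero (B : HorizonBox S φ κ₀ Λ W) (B' : HorizonBox S' φ' κ₀ Λ W)
    (hF : ∀ y ∈ W, y 3 = 0 → ∀ j, j ≠ 3 → comp2 S.F φ 2 j y = 0)
    (hF' : ∀ y ∈ W, y 3 = 0 → ∀ j, j ≠ 3 → comp2 S'.F φ' 2 j y = 0)
    (h01 : ∀ y ∈ W, y 3 = 0 → comp2 S.F φ 0 1 y = comp2 S'.F φ' 0 1 y)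
    (h23 : ∀ y ∈ W, y 3 = 0 → comp2 S.F φ 2 3 y = comp2 S'.F φ' 2 3 y) :
    FieldJet S S' φ φ' W 0 1 1 2 0 := by
  have hW := B.isOpen
  have sF := B.F_smooth
  have sF' := B'.F_smooth
  have F23 : Jet W 0 (0, 1) (comp2 S.F φ 2 3) (comp2 S'.F φ' 2 3) :=
    ⟨sF 2 3, sF' 2 3, trivial, trivial, fun y hy h3 => sub_eq_zero.2 (h23 y hy h3), trivial⟩
  have F01 : Jet W 0 (0, 1) (comp2 S.F φ 0 1) (comp2 S'.F φ' 0 1) :=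
    ⟨sF 0 1, sF' 0 1, trivial, trivial, fun y hy h3 => sub_eq_zero.2 (h01 y hy h3), trivial⟩
  have FA2 : ∀ i, i < 2 → Jet W 0 (1, 2) (comp2 S.F φ i 2) (comp2 S'.F φ' i 2) := by
    intro i hi
    have hi3 : i ≠ 3 := by rintro rfl; exact absurd hi (by decide)
    have d := ((F23.pd_of_ne hW hi3).const_mul hW (-1)).congr hW
      (g := pd 3 (comp2 S.F φ i 2)) (g' := pd 3 (comp2 S'.F φ' i 2))
      (fun y hy => by linarith [B.maxwell i 2 3 y hy, B.F_stat 3 i y hy])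
      (fun y hy => by linarith [B'.maxwell i 2 3 y hy, B'.F_stat 3 i y hy])
    have z : ∀ y ∈ W, y 3 = 0 → comp2 S.F φ i 2 y = 0 := fun y hy h3 => by
      rw [B.F_antisymm, hF y hy h3 i hi3, neg_zero]
    have z' : ∀ y ∈ W, y 3 = 0 → comp2 S'.F φ' i 2 y = 0 := fun y hy h3 => by
      rw [B'.F_antisymm, hF' y hy h3 i hi3, neg_zero]
    have F0 : Jet W 0 (1, 1) (comp2 S.F φ i 2) (comp2 S'.F φ' i 2) :=
      ⟨sF i 2, sF' i 2, ⟨z, trivial⟩, ⟨z', trivial⟩,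
        fun y hy h3 => sub_eq_zero.2 ((z y hy h3).trans (z' y hy h3).symm), trivial⟩
    exact F0.of_pd_three (s := (1, 1)) hW (k := 1) d.diff
  refine fieldJet_of_ne B B' fun i j hij => ?_
  by_cases hj : j = 3
  · subst hj
    by_cases hi : i = 2
    · subst hi; exact F23
    -- Nothing is known about F_rA initially, and order 0 demands nothing; its horizon value is
    -- first supplied by `fieldJet_radial`.
    · have : Jet W 0 (0, 0) (comp2 S.F φ i 3) (comp2 S'.F φ' i 3) :=
        ⟨sF i 3, sF' i 3, trivial, trivial, trivial⟩
      exact this.mono (by clear this; revert i; decide)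
  by_cases hj2 : j = 2
  · subst hj2
    exact (FA2 i hij).mono (by clear * - hij; revert i; decide)
  · obtain ⟨rfl, rfl⟩ : i = 0 ∧ j = 1 := by clear * - hij hj hj2; revert i j; decide
    exact F01

/-- As g^{rA} vanishes on the horizon, the pullback of ⋆F encodes F_vr, a component that the
pullback of F does not see. -/
theorem HorizonBox.starF_horizon (B : HorizonBox S φ κ₀ Λ W) {y : Coord} (hy : y ∈ W)
    (h3 : y 3 = 0) : S.starF φ 0 1 y = comp4 S.vol φ 0 1 2 3 y * comp2 S.F φ 3 2 y := by
  rw [B.starF_zero_one, B.fieldUp_two_three hy, B.ginv_three_null hy h3 (j := 0) (by decide),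
    B.ginv_three_null hy h3 (j := 1) (by decide)]
  ring

/-- All radial derivatives of the metric, the field and the Christoffel symbols agree. -/
theorem jetAll_of_horizon (B : HorizonBox S φ κ₀ Λ W) (B' : HorizonBox S' φ' κ₀ Λ W)
    (h0 : ∀ y ∈ W, y 3 = 0 → comp4 S.vol φ 0 1 2 3 y = comp4 S'.vol φ' 0 1 2 3 y)
    (G : MetricJet S S' φ φ' W 0 1 2 2) (F : FieldJet S S' φ φ' W 0 1 1 2 0) :
    (∀ i j, JetAll W (comp2 S.g φ i j) (comp2 S'.g φ' i j)) ∧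
    (∀ i j, JetAll W (comp2 S.F φ i j) (comp2 S'.F φ' i j)) ∧
    (∀ k i j, JetAll W (S.Gam φ k i j) (S'.Gam φ' k i j)) := by
  have h := horizonBox_jets B B' h0 G F
  refine ⟨fun i j n => ((h n).1 i j).mono ?_, fun i j n => ?_, fun k i j n => ?_⟩
  · revert i j; decide
  -- Level n + 1 is used because F_rA is only known to order n at level n; likewise below for Γ,
  -- which contains ∂_r g_AB.
  · have := (h (n + 1)).2 i j
    exact ⟨this.smooth, this.smooth', trivial, trivial, this.diff.mono (Nat.le_add_right _ _)⟩
  · have := jet_Gam B B' (by decide) (by decide) (by decide) (h (n + 1)).1 k i j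
    exact ⟨this.smooth, this.smooth', trivial, trivial, this.diff.mono (Nat.le_add_right _ _)⟩

end HorizonData

end EMHorizon

end

/-! ### The corollary: from the given horizon data to all radial derivatives -/

theorem mainTheorem9
    {M M' : Type*}
    [TopologicalSpace M] [ChartedSpace Coord M] [IsManifold 𝓘(ℝ, Coord) ∞ M]
    [TopologicalSpace M'] [ChartedSpace Coord M'] [IsManifold 𝓘(ℝ, Coord) ∞ M']
    -- two electrovac spacetimes (with the same constants)
    (κ₀ Λ : ℝ) (hκ₀ : 0 < κ₀)
    (S : EMSpacetime M) (hS : S.IsElectrovac κ₀ Λ)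
    (S' : EMSpacetime M') (hS' : S'.IsElectrovac κ₀ Λ)
    -- a Killing horizon of nowhere vanishing surface gravity in each of them
    (H : Set M) (K : VField M) (hH : IsKillingHorizon S H K)
    (κ : M → ℝ) (hκ : IsSurfaceGravity S H K κ) (hκ_ne : ∀ p ∈ H, κ p ≠ 0)
    (H' : Set M') (K' : VField M') (hH' : IsKillingHorizon S' H' K')
    (κ' : M' → ℝ) (hκ' : IsSurfaceGravity S' H' K' κ') (hκ_ne' : ∀ p ∈ H', κ' p ≠ 0)
    -- Bondi-like coordinates, adapted null frames, and rotation 1-forms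
    (φ : Chart M) (hφ : IsBondiChart S H K φ)
    (e : Fin 4 → Coord → Fin 4 → ℂ) (he : IsAdaptedFrame S φ e)
    (rot : (Fin 3 → ℝ) → Fin 3 → ℝ) (h_rot : IsRotationForm S K φ rot)
    (φ' : Chart M') (hφ' : IsBondiChart S' H' K' φ')
    (e' : Fin 4 → Coord → Fin 4 → ℂ) (he' : IsAdaptedFrame S' φ' e')
    (rot' : (Fin 3 → ℝ) → Fin 3 → ℝ) (h_rot' : IsRotationForm S' K' φ' rot')
    -- an open set `U` of horizon coordinates `(x¹, x², v)` on which the data coincide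
    (U : Set (Fin 3 → ℝ)) (hU : IsOpen U)
    (hUφ : ∀ h ∈ U, onHorizon h ∈ φ.target) (hUφ' : ∀ h ∈ U, onHorizon h ∈ φ'.target)
    (h_m : ∀ h ∈ U, ∀ k, e 0 (onHorizon h) k = e' 0 (onHorizon h) k)
    (h_rot_eq : ∀ h ∈ U, ∀ a, rot h a = rot' h a)
    (h_F : ∀ h ∈ U, ∀ a b, pullbackF S φ h a b = pullbackF S' φ' h a b) :
    ∀ h ∈ U, ∀ n : ℕ,
      (∀ a k, radialDeriv n (fun y => e a y k) h = radialDeriv n (fun y => e' a y k) h) ∧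
      (∀ a k, radialDeriv n (coframe e a k) h = radialDeriv n (coframe e' a k) h) ∧
      (∀ I, radialDeriv n (maxwellScalar S φ e I) h
        = radialDeriv n (maxwellScalar S' φ' e' I) h) := by
  intro h hh n
  have hne : κ₀ ≠ 0 := hκ₀.ne'
  -- a cube of coordinate values around the given point
  let N : Set Coord := {y | (fun i : Fin 3 => y i.castSucc) ∈ U} ∩ (φ.target ∩ φ'.target)
  have hN : IsOpen N := (hU.preimage (by fun_prop)).inter (φ.open_target.inter φ'.open_target)
  have hpN : onHorizon h ∈ N := by
    refine ⟨?_, hUφ h hh, hUφ' h hh⟩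
    have : (fun i : Fin 3 => onHorizon h i.castSucc) = h := by
      ext i; fin_cases i <;> rfl
    show (fun i : Fin 3 => onHorizon h i.castSucc) ∈ U
    rwa [this]
  obtain ⟨ε, hε, hball⟩ := Metric.isOpen_iff.1 hN _ hpN
  have hp : onHorizon h 3 = 0 := rfl
  have hsub : Metric.ball (onHorizon h) ε ⊆ φ.target := fun y hy => (hball hy).2.1
  have hsub' : Metric.ball (onHorizon h) ε ⊆ φ'.target := fun y hy => (hball hy).2.2
  have hpt : ∀ y ∈ Metric.ball (onHorizon h) ε, y 3 = 0 → ∃ x ∈ U, onHorizon x = y := by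
    intro y hy h3
    refine ⟨_, (hball hy).1, ?_⟩
    ext i; fin_cases i <;> first | rfl | exact h3.symm
  have hW : IsOpen (Metric.ball (onHorizon h) ε) := Metric.isOpen_ball
  have B := horizonBox_of_killingHorizon hS hH hκ hκ_ne hφ he hp hsub
  have B' := horizonBox_of_killingHorizon hS' hH' hκ' hκ_ne' hφ' he' hp hsub'
  -- the horizon data agree
  have hE : ∀ y ∈ Metric.ball (onHorizon h) ε, y 3 = 0 → ∀ a k, e a y k = e' a y k := by
    intro y hy h3 a k
    obtain ⟨x, hx, rfl⟩ := hpt y hy h3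
    fin_cases a
    · exact h_m x hx k
    · exact (he.conj_m _ (hsub hy) k).trans (by
        rw [h_m x hx k]; exact (he'.conj_m _ (hsub' hy) k).symm)
    · exact (he.n_eq _ (hsub hy) k).trans (he'.n_eq _ (hsub' hy) k).symm
    · exact (he.ell_horizon _ (hsub hy) h3 k).trans (he'.ell_horizon _ (hsub' hy) h3 k).symm
  have hg := fun y hy h3 => g_eq_of_frame_eq he he' (hsub hy) (hsub' hy) (hE y hy h3)
  have hv := fun y hy h3 => vol_eq_of_frame_eq he he' (hsub hy) (hsub' hy) (hE y hy h3)
  -- The v-component of ∇_j ℓ = ω_j ℓ is ω_j itself, since ℓ^v = 1, and equals -½ ∂_r g_jv.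
  have hdg : ∀ y ∈ Metric.ball (onHorizon h) ε, y 3 = 0 → ∀ j, j ≠ 3 →
      pd 3 (comp2 S.g φ 2 j) y = pd 3 (comp2 S'.g φ' 2 j) y := by
    intro y hy h3 j hj
    have e1 := nablaV_two hH hφ he hp hsub j y hy
    have e2 := nablaV_two hH' hφ' he' hp hsub' j y hy
    obtain ⟨x, hx, rfl⟩ := hpt y hy h3
    obtain ⟨a, rfl⟩ : ∃ a : Fin 3, a.castSucc = j := Fin.exists_castSucc_eq.2 hj
    rw [h_rot x (hsub hy) a 2, hφ.ell _ (hsub hy) h3] at e1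
    rw [h_rot' x (hsub' hy) a 2, hφ'.ell _ (hsub' hy) h3, ← h_rot_eq x hx a] at e2
    rw [B.g_symm, B'.g_symm]
    linarith
  have h01 : ∀ y ∈ Metric.ball (onHorizon h) ε, y 3 = 0 →
      comp2 S.F φ 0 1 y = comp2 S'.F φ' 0 1 y := by
    intro y hy h3
    obtain ⟨x, hx, rfl⟩ := hpt y hy h3
    simpa [pullbackF] using congrArg Complex.re (h_F x hx 0 1)
  have h23 : ∀ y ∈ Metric.ball (onHorizon h) ε, y 3 = 0 →
      comp2 S.F φ 2 3 y = comp2 S'.F φ' 2 3 y := by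
    intro y hy h3
    -- The imaginary part of the pullback of F - i⋆F; dividing by the common volume component leaves
    -- F_rv.
    have hs : S.starF φ 0 1 y = S'.starF φ' 0 1 y := by
      obtain ⟨x, hx, rfl⟩ := hpt y hy h3
      simpa [pullbackF] using congrArg Complex.im (h_F x hx 0 1)
    rw [B.starF_horizon hy h3, B'.starF_horizon hy h3, ← hv y hy h3] at hs
    rw [B.F_antisymm, B'.F_antisymm, mul_left_cancel₀ (B.vol_ne hy) hs]
  obtain ⟨G, F, Γ⟩ := jetAll_of_horizon B B' hv (metricJet_zero B B' hg hdg)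
    (fieldJet_zero B B' (fun y hy h3 j hj => B.field_null hne he hsub hy h3 hj)
      (fun y hy h3 j hj => B'.field_null hne he' hsub' hy h3 hj) h01 h23)
  have E := jetAll_frame hW hsub hsub' he he' Γ hE
  have hh0 : onHorizon h ∈ Metric.ball (onHorizon h) ε := Metric.mem_ball_self hε
  exact ⟨fun a k => (E a k).radialDeriv_eq hW hh0 n,
    fun a k => (jetAll_coframe hW hsub hsub' he he' G E a k).radialDeriv_eq hW hh0 n,
    fun I => (jetAll_maxwellScalar hW F E I).radialDeriv_eq hW hh0 n⟩
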